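/- **Setting.** A \emph{gliding system} in a group $G$ is a pair $(\mathcal G\subset G\setminus\{1\},\ \mathcal I\subset\mathcal G\times\mathcal G)$ such that: $s\in\mathcal G\Rightarrow s^{-1}\in\mathcal G$; if $(s,t)\in\mathcal I$ then $st=ts$ and $(s^{-1},t),(t,s)\in\mathcal I$; and $(s,s)\notin\mathcal I$ for all $s\in\mathcal G$. Elements of $\mathcal G$ are \emph{glides}, and $s,t$ are \emph{independent} if $(s,t)\in\mathcal I$. For a finite set $S$ of pairwise independent glides put $[S]=\prod_{s\in S}s$. Such an $S$ is \emph{cubic} if $[T_1]\ne[T_2]$ for all distinct $T_1,T_2\subset S$. A \emph{based cube} is a pair $(A,S)$ with $A\in G$ and $S$ a cubic set of glides; its vertices are the elements $[T]A$, $T\subset S$. For $T\subset S$ let $S_T=(S\setminus T)\cup\{t^{-1}\}_{t\in T}$. Based cubes $(A,S)$ and $(A',S')$ are equivalent if $A'=[T]A$ and $S'=S_T$ for some $T\subset S$; a \emph{cube} in $G$ is an equivalence class of based cubes, and its vertices are those of any representative. A cube $Q$ is a \emph{face} of a cube $Q'$ if they have representatives $(A,S)$ and $(A,S')$ with $S\subset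 S'$. Let $\mathcal E\subset G$. A \emph{cube in $\mathcal E$} is a cube all of whose vertices lie in $\mathcal E$. For $J\subset\mathcal E$, a \emph{hull of $J$ in $\mathcal E$} is a cube in $\mathcal E$ whose vertex set contains $J$ and which is a face of every cube in $\mathcal E$ whose vertex set contains $J$; it is unique if it exists. The \emph{glide complex} $X_{\mathcal E}$ is the quotient space of the disjoint union of the geometric cubes $\{(A,S,x): x\colon S\to[0,1]\}$, over all based cubes $(A,S)$ with all vertices in $\mathcal E$, by the equivalence relation generated by: $(A,S,x)\sim(A',S',x')$ if either $A=A'$, $S\subset S'$, $x=x'|_S$ and $x'(S'\setminus S)=0$; or, for some $T\subset S$, $A'=[T]A$, $S'=S_T$, $x'=x$ on $S\setminus T$ and $x'(t^{-1})=1-x(t)$ for $t\in T$. Elements of $\mathcal E$ are regarded as the $0$-cells of $X_{\mathcal E}$, and each cube in $\mathcal E$ as a closed cell of $X_{\mathcal E}$. **Theorem.** Let $G$ be a group with a gliding system and let $\mathcal E\subset G$ be a set such that each $2$-element subset of $\mathcal E$ has a hull in $\mathcal E$. Then $X_{\mathcal E}$ is connected (if $\mathcal E\neq\emptyset$), and for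 each $A_0\in\mathcal E$ there is an isomorphism onto $\pi_1(X_{\mathcal E},A_0)$ (where $[\alpha][\beta]$ is the class of the loop running along $\alpha$ first, then $\beta$) from the group with generators $\{y_{A,B}\}_{A,B\in\mathcal E}$ and relations $$y_{A,C}=y_{A,B}\,y_{B,C}\ \text{ for all (not necessarily distinct) vertices } A,B,C \text{ of a cube in } \mathcal E,\qquad y_{A_0,A}=1\ \text{ for all } A\in\mathcal E,$$ such that, for all $A,B\in\mathcal E$, the image of $y_{A,B}$ is represented by any loop composed of a path in $X_{\mathcal E}$ from $A_0$ to $A$ in the hull of $\{A_0,A\}$, a path from $A$ to $B$ in the hull of $\{A,B\}$, and a path from $B$ to $A_0$ in the hull of $\{A_0,B\}$; such loops exist. -/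

import Mathlib

open scoped unitInterval

/-- A gliding system in a group `G`: a set of glides together with a binary relation of
independence on it. -/
structure GlidingSystem (G : Type*) [Group G] where
  /-- the set of glides -/
  glides : Set G
  /-- the set of ordered pairs of independent glides -/
  indep : Set (G × G)
  one_notMem : (1 : G) ∉ glides
  indep_subset : indep ⊆ glides ×ˢ glides
  inv_mem : ∀ s ∈ glides, s⁻¹ ∈ glides
  comm : ∀ s t, (s, t) ∈ indep → s * t = t * s
  inv_left : ∀ s t, (s, t) ∈ indep → (s⁻¹, t) ∈ indep
  symm : ∀ s t, (s, t) ∈ indep → (t, s) ∈ indep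
  irrefl : ∀ s ∈ glides, (s, s) ∉ indep

namespace GlidingSystem

variable {G : Type*} [Group G] (Γ : GlidingSystem G)

/-- A finite set of independent glides. -/
def IsIndep (S : Finset G) : Prop :=
  (S : Set G) ⊆ Γ.glides ∧ (S : Set G).Pairwise fun s t => (s, t) ∈ Γ.indep

variable {Γ}

theorem IsIndep.subset {S T : Finset G} (hS : Γ.IsIndep S) (h : T ⊆ S) : Γ.IsIndep T :=
  ⟨fun _ hx => hS.1 (h hx), hS.2.mono (Finset.coe_subset.2 h)⟩

theorem IsIndep.commute {S : Finset G} (hS : Γ.IsIndep S) :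
    (S : Set G).Pairwise (Function.onFun Commute id) :=
  fun s hs t ht hst => Γ.comm s t (hS.2 hs ht hst)

/-- The product `[S]` of a finite set of independent glides. -/
def bracket (S : Finset G) (hS : Γ.IsIndep S) : G := S.noncommProd id hS.commute

variable (Γ)

/-- A cubic set of glides: a finite set of independent glides whose distinct subsets have
distinct products. -/
def IsCubic (S : Finset G) : Prop :=
  ∃ hS : Γ.IsIndep S, ∀ (T₁ T₂ : Finset G) (h₁ : T₁ ⊆ S) (h₂ : T₂ ⊆ S),
    T₁ ≠ T₂ → bracket T₁ (hS.subset h₁) ≠ bracket T₂ (hS.subset h₂)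

open Classical in
/-- The set `S_T` obtained from `S` by inverting the elements of `T ⊆ S`. -/
noncomputable def flip (S T : Finset G) : Finset G := (S \ T) ∪ T.image (·⁻¹)

/-- A based cube in `G`: an element of `G` and a cubic set of glides. -/
structure BasedCube where
  base : G
  dirs : Finset G
  cubic : Γ.IsCubic dirs

variable {Γ}

theorem IsCubic.isIndep {S : Finset G} (h : Γ.IsCubic S) : Γ.IsIndep S := h.1

theorem BasedCube.indep_of_subset (c : Γ.BasedCube) {T : Finset G} (h : T ⊆ c.dirs) :
    Γ.IsIndep T := c.cubic.isIndep.subset h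

/-- The vertices `[T]A`, `T ⊆ S`, of a based cube `(A, S)`. -/
def BasedCube.vertices (c : Γ.BasedCube) : Set G :=
  {B | ∃ (T : Finset G) (h : T ⊆ c.dirs), B = bracket T (c.indep_of_subset h) * c.base}

/-- `(A, S)` and `(A', S')` are equivalent if `A' = [T]A` and `S' = S_T` for some `T ⊆ S`. -/
def BasedCube.Equiv (c c' : Γ.BasedCube) : Prop :=
  ∃ (T : Finset G) (h : T ⊆ c.dirs),
    c'.base = bracket T (c.indep_of_subset h) * c.base ∧ c'.dirs = flip c.dirs T

/-! Verification that this is an equivalence relation and that equivalent based cubes have the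
same vertices. -/

theorem bracket_congr {S T : Finset G} (hS : Γ.IsIndep S) (hT : Γ.IsIndep T) (h : S = T) :
    bracket S hS = bracket T hT := by
  subst h; rfl

theorem bracket_empty (h : Γ.IsIndep (∅ : Finset G)) : bracket (∅ : Finset G) h = 1 := rfl

open Classical in
theorem bracket_union {S T : Finset G} (h : Γ.IsIndep (S ∪ T)) (hd : Disjoint S T) :
    bracket (S ∪ T) h = bracket S (h.subset Finset.subset_union_left) *
      bracket T (h.subset Finset.subset_union_right) :=
  Finset.noncommProd_union_of_disjoint hd _ _

open Classical in
theorem bracket_inv_mul {S : Finset G} (h : Γ.IsIndep S) (h' : Γ.IsIndep (S.image (·⁻¹))) :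
    bracket (S.image (·⁻¹)) h' * bracket S h = 1 := by
  induction S using Finset.induction_on with
  | empty => exact one_mul 1
  | insert a S ha ih =>
    have e1 : bracket (insert a S) h = a * bracket S (h.subset (Finset.subset_insert _ _)) :=
      Finset.noncommProd_insert_of_notMem _ _ _ _ ha
    have h3 : Γ.IsIndep (insert a⁻¹ (S.image (·⁻¹))) := by
      rw [← Finset.image_insert (f := (·⁻¹))]; exact h'
    have ha' : a⁻¹ ∉ S.image (·⁻¹) := by simpa using ha
    have e2 : bracket ((insert a S).image (·⁻¹)) h' =
        bracket (S.image (·⁻¹)) (h3.subset (Finset.subset_insert _ _)) * a⁻¹ :=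
      (bracket_congr h' h3 (Finset.image_insert _ _ _)).trans
        (Finset.noncommProd_insert_of_notMem' _ _ _ _ ha')
    rw [e1, e2, mul_assoc, inv_mul_cancel_left]
    exact ih _ _

open Classical in
theorem bracket_flip {S T U : Finset G} (hS : Γ.IsIndep S) (hT : T ⊆ S) (hU : U ⊆ S)
    (hF : Γ.IsIndep ((U \ T) ∪ (T \ U).image (·⁻¹)))
    (hd : Disjoint (U \ T) ((T \ U).image (·⁻¹))) :
    bracket _ hF * bracket T (hS.subset hT) = bracket U (hS.subset hU) := by
  have eT : T \ U ∪ T ∩ U = T := Finset.sdiff_union_inter T U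
  have eU : U \ T ∪ T ∩ U = U := by rw [Finset.inter_comm]; exact Finset.sdiff_union_inter U T
  have dT : Disjoint (T \ U) (T ∩ U) := Finset.disjoint_sdiff_inter T U
  have dU : Disjoint (U \ T) (T ∩ U) := by
    rw [Finset.inter_comm]; exact Finset.disjoint_sdiff_inter U T
  rw [bracket_union hF hd,
    bracket_congr (hS.subset hT) (by rw [eT]; exact hS.subset hT) eT.symm,
    bracket_congr (hS.subset hU) (by rw [eU]; exact hS.subset hU) eU.symm,
    bracket_union _ dT, bracket_union _ dU, mul_assoc, ← mul_assoc (bracket ((T \ U).image _) _),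
    bracket_inv_mul, one_mul]

theorem IsIndep.inv_eq_self {S : Finset G} (hS : Γ.IsIndep S) {s t : G} (hs : s ∈ S) (ht : t ∈ S)
    (h : s = t⁻¹) : s = t := by
  by_contra hne
  have h1 := Γ.inv_left _ _ (hS.2 ht hs (Ne.symm hne))
  rw [← h] at h1
  exact Γ.irrefl s (hS.1 hs) h1

theorem mem_flip {S T : Finset G} {x : G} :
    x ∈ flip S T ↔ (x ∈ S ∧ x ∉ T) ∨ ∃ t ∈ T, t⁻¹ = x := by
  classical
  simp [flip]

theorem flip_empty (S : Finset G) : flip S ∅ = S := by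
  ext x; simp [mem_flip]

open Classical in
/-- A subset of `S_T` has the form `(U \ T) ∪ (T \ U)⁻¹` with `U ⊆ S`. -/
theorem exists_subset_flip {S T V : Finset G} (hS : Γ.IsIndep S) (hT : T ⊆ S)
    (hV : V ⊆ flip S T) : ∃ U ⊆ S, V = (U \ T) ∪ (T \ U).image (·⁻¹) ∧
      Disjoint (U \ T) ((T \ U).image (·⁻¹)) ∧ flip (flip S T) V = flip S U := by
  have key : ∀ s ∈ S, ∀ t ∈ S, s = t⁻¹ → s = t := fun s hs t ht h => hS.inv_eq_self hs ht h
  refine ⟨(S \ T).filter (· ∈ V) ∪ T.filter (fun t => t⁻¹ ∉ V), ?_, ?_, ?_, ?_⟩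
  · intro x hx
    simp only [Finset.mem_union, Finset.mem_filter, Finset.mem_sdiff] at hx
    rcases hx with hx | hx
    · exact hx.1.1
    · exact hT hx.1
  · ext x
    simp only [Finset.mem_union, Finset.mem_filter, Finset.mem_sdiff, Finset.mem_image]
    constructor
    · intro hx
      rcases mem_flip.1 (hV hx) with h | ⟨t, ht, rfl⟩
      · grind
      · right
        refine ⟨t, ⟨ht, ?_⟩, rfl⟩
        grind
    · rintro (h | ⟨t, h, rfl⟩) <;> grind
  · rw [Finset.disjoint_left]
    intro x hx hx'
    simp only [Finset.mem_union, Finset.mem_filter, Finset.mem_sdiff, Finset.mem_image] at hx hx'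
    obtain ⟨t, ht, rfl⟩ := hx'
    have h1 : t⁻¹ ∈ S := by grind
    have h2 := key _ h1 t (hT ht.1) rfl
    grind
  · ext x
    simp only [mem_flip, Finset.mem_union, Finset.mem_filter, Finset.mem_sdiff]
    constructor
    · rintro (⟨h | ⟨t, ht, rfl⟩, hx⟩ | ⟨v, hv, rfl⟩)
      · left; grind
      · right; exact ⟨t, by grind, rfl⟩
      · rcases mem_flip.1 (hV hv) with h | ⟨t, ht, rfl⟩
        · right; exact ⟨v, by grind, rfl⟩
        · rw [inv_inv]
          left; grind
    · rintro (⟨hx, hx'⟩ | ⟨t, ht, rfl⟩)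
      · by_cases hxT : x ∈ T
        · right; exact ⟨x⁻¹, by grind, inv_inv x⟩
        · left; grind
      · rcases ht with ht | ht
        · right; exact ⟨t, by grind, rfl⟩
        · left; grind

theorem BasedCube.Equiv.refl (c : Γ.BasedCube) : c.Equiv c :=
  ⟨∅, Finset.empty_subset _, by rw [bracket_empty, one_mul], (flip_empty _).symm⟩

theorem BasedCube.Equiv.exists_subset {c c' : Γ.BasedCube} (h : c.Equiv c') {V : Finset G}
    (hV : V ⊆ c'.dirs) : ∃ (U : Finset G) (hU : U ⊆ c.dirs),
      bracket V (c'.indep_of_subset hV) * c'.base = bracket U (c.indep_of_subset hU) * c.base ∧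
        flip c'.dirs V = flip c.dirs U := by
  classical
  obtain ⟨T, hT, hb, hd⟩ := h
  obtain ⟨U, hU, rfl, hdj, hf⟩ := exists_subset_flip c.cubic.isIndep hT (hd ▸ hV)
  refine ⟨U, hU, ?_, by rw [hd, hf]⟩
  rw [hb, ← mul_assoc, bracket_flip c.cubic.isIndep hT hU _ hdj]

theorem BasedCube.Equiv.trans {c c' c'' : Γ.BasedCube} (h : c.Equiv c') (h' : c'.Equiv c'') :
    c.Equiv c'' := by
  obtain ⟨V, hV, hb, hd⟩ := h'
  obtain ⟨U, hU, e, f⟩ := h.exists_subset hV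
  exact ⟨U, hU, hb.trans e, hd.trans f⟩

theorem BasedCube.Equiv.symm {c c' : Γ.BasedCube} (h : c.Equiv c') : c'.Equiv c := by
  classical
  obtain ⟨T, hT, hb, hd⟩ := h
  have hV : T.image (·⁻¹) ⊆ c'.dirs := by
    rw [hd, flip]; exact Finset.subset_union_right
  refine ⟨T.image (·⁻¹), hV, ?_, ?_⟩
  · rw [hb, ← mul_assoc, bracket_inv_mul, one_mul]
  · rw [hd]
    have key : ∀ s ∈ c.dirs, ∀ t ∈ c.dirs, s = t⁻¹ → s = t :=
      fun s hs t ht h => c.cubic.isIndep.inv_eq_self hs ht h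
    ext x
    simp only [mem_flip, Finset.mem_image, exists_exists_and_eq_and, inv_inv, exists_eq_right]
    grind

variable (Γ) in
instance BasedCube.setoid : Setoid Γ.BasedCube :=
  ⟨BasedCube.Equiv, BasedCube.Equiv.refl, BasedCube.Equiv.symm, BasedCube.Equiv.trans⟩

theorem BasedCube.Equiv.vertices_subset {c c' : Γ.BasedCube} (h : c.Equiv c') :
    c'.vertices ⊆ c.vertices := by
  rintro B ⟨V, hV, rfl⟩
  obtain ⟨U, hU, e, -⟩ := h.exists_subset hV
  exact ⟨U, hU, e⟩

variable (Γ) in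
/-- A cube in `G`: an equivalence class of based cubes. -/
def Cube := Quotient (BasedCube.setoid Γ)

/-- The cube represented by a based cube. -/
def BasedCube.toCube (c : Γ.BasedCube) : Γ.Cube := Quotient.mk _ c

/-- The set of vertices of a cube. -/
def Cube.vertices : Γ.Cube → Set G :=
  Quotient.lift BasedCube.vertices fun _ _ h =>
    Set.Subset.antisymm (BasedCube.Equiv.vertices_subset (BasedCube.Equiv.symm h))
      (BasedCube.Equiv.vertices_subset h)

/-- `Q` is a face of `Q'` if they are represented by `(A, S)` and `(A, S')` with `S ⊆ S'`. -/
def Cube.IsFace (Q Q' : Γ.Cube) : Prop :=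
  ∃ c c' : Γ.BasedCube, c.toCube = Q ∧ c'.toCube = Q' ∧ c.base = c'.base ∧ c.dirs ⊆ c'.dirs

/-- `Q` is a cube in the set `E`: all its vertices lie in `E`. -/
def Cube.IsIn (Q : Γ.Cube) (E : Set G) : Prop := Q.vertices ⊆ E

/-- `Q` is the hull of `J` in `E`: a cube in `E` whose vertices include `J` and which is a face of
every cube in `E` whose vertices include `J`. -/
def Cube.IsHull (Q : Γ.Cube) (E J : Set G) : Prop :=
  Q.IsIn E ∧ J ⊆ Q.vertices ∧ ∀ Q' : Γ.Cube, Q'.IsIn E → J ⊆ Q'.vertices → Q.IsFace Q'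

variable (Γ) in
/-- A point `(A, S, x : S → [0,1])` of the disjoint union of geometric cubes over all based cubes
`(A, S)` whose vertices lie in `E`. -/
abbrev CubePoint (E : Set G) : Type _ :=
  Σ c : {c : Γ.BasedCube // c.vertices ⊆ E}, (c.1.dirs → I)

/-- The identifications of points of geometric cubes that define the glide complex. -/
inductive Glue (E : Set G) : Γ.CubePoint E → Γ.CubePoint E → Prop
  /-- inclusion of a face through the base vertex -/
  | face (c c' : {c : Γ.BasedCube // c.vertices ⊆ E}) (x : c.1.dirs → I) (x' : c'.1.dirs → I)
      (hbase : c.1.base = c'.1.base) (hdirs : c.1.dirs ⊆ c'.1.dirs)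
      (hx : ∀ s (hs : s ∈ c.1.dirs), x ⟨s, hs⟩ = x' ⟨s, hdirs hs⟩)
      (h0 : ∀ s : c'.1.dirs, s.1 ∉ c.1.dirs → x' s = 0) :
      Glue E ⟨c, x⟩ ⟨c', x'⟩
  /-- change of the base vertex -/
  | rebase (c c' : {c : Γ.BasedCube // c.vertices ⊆ E}) (x : c.1.dirs → I) (x' : c'.1.dirs → I)
      (T : Finset G) (hT : T ⊆ c.1.dirs)
      (hbase : c'.1.base = bracket T (c.1.indep_of_subset hT) * c.1.base)
      (hdirs : c'.1.dirs = flip c.1.dirs T)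
      (hx : ∀ s (hs : s ∈ c.1.dirs) (hs' : s ∈ c'.1.dirs), s ∉ T → x' ⟨s, hs'⟩ = x ⟨s, hs⟩)
      (hxT : ∀ t (ht : t ∈ T) (ht' : t⁻¹ ∈ c'.1.dirs), x' ⟨t⁻¹, ht'⟩ = σ (x ⟨t, hT ht⟩)) :
      Glue E ⟨c, x⟩ ⟨c', x'⟩

variable (Γ) in
/-- The glide complex `X_E`: the quotient of the disjoint union of the geometric cubes over all
based cubes in `E` by the equivalence relation generated by the identifications above, with the
quotient topology. -/
def GlideComplex (E : Set G) : Type _ := Quot (Glue (Γ := Γ) E)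

instance (E : Set G) : TopologicalSpace (Γ.GlideComplex E) :=
  inferInstanceAs (TopologicalSpace (Quot (Glue (Γ := Γ) E)))

/-- The closed cell of `X_E` formed by the points of a cube `Q`. -/
def Cube.cell (Q : Γ.Cube) (E : Set G) : Set (Γ.GlideComplex E) :=
  {p | ∃ (c : {c : Γ.BasedCube // c.vertices ⊆ E}) (x : c.1.dirs → I),
    c.1.toCube = Q ∧ p = Quot.mk _ ⟨c, x⟩}

theorem isIndep_empty : Γ.IsIndep (∅ : Finset G) := by
  simp [IsIndep]

theorem isCubic_empty : Γ.IsCubic (∅ : Finset G) :=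
  ⟨isIndep_empty, fun _ _ h₁ h₂ h =>
    absurd ((Finset.subset_empty.1 h₁).trans (Finset.subset_empty.1 h₂).symm) h⟩

variable (Γ) in
/-- The based `0`-cube `(A, ∅)`. -/
def zeroCube (A : G) : Γ.BasedCube := ⟨A, ∅, isCubic_empty⟩

theorem zeroCube_vertices (A : G) : (Γ.zeroCube A).vertices = {A} := by
  ext B
  constructor
  · rintro ⟨T, hT, rfl⟩
    obtain rfl := Finset.subset_empty.1 hT
    exact one_mul A
  · rintro rfl
    exact ⟨∅, Finset.empty_subset _, (one_mul _).symm⟩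

variable (Γ) in
/-- The `0`-cell of `X_E` given by an element `A` of `E`. -/
def vertex {E : Set G} (A : E) : Γ.GlideComplex E :=
  Quot.mk _ ⟨⟨Γ.zeroCube A, by
    rw [zeroCube_vertices]; exact Set.singleton_subset_iff.2 A.2⟩, fun _ => 0⟩

variable (Γ) in
/-- The relators of the presentation on the generators `y_{A,B}`, `A, B ∈ E`:
`y_{A,B} y_{B,C} = y_{A,C}` for vertices `A, B, C` of a cube in `E`, and `y_{A₀,A} = 1`. -/
def relators (E : Set G) (A₀ : E) : Set (FreeGroup (E × E)) :=
  {r | ∃ (A B C : E) (Q : Γ.Cube), Q.IsIn E ∧ (A : G) ∈ Q.vertices ∧ (B : G) ∈ Q.vertices ∧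
      (C : G) ∈ Q.vertices ∧
      r = FreeGroup.of (A, B) * FreeGroup.of (B, C) * (FreeGroup.of (A, C))⁻¹} ∪
  {r | ∃ A : E, r = FreeGroup.of (A₀, A)}

variable (Γ) in
/-- The path `p` from `A` to `B` runs in the hull of `{A, B}` in `E`. -/
def InHull {E : Set G} {A B : E} (p : Path (Γ.vertex A) (Γ.vertex B)) : Prop :=
  ∃ Q : Γ.Cube, Q.IsHull E {(A : G), (B : G)} ∧ ∀ t, p t ∈ Q.cell E

variable (Γ) in
/-- The loop `γ` at `A₀` is composed of a path from `A₀` to `A` in the hull of `{A₀, A}`, a path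
from `A` to `B` in the hull of `{A, B}` and a path from `B` to `A₀` in the hull of `{A₀, B}`. -/
def IsHullLoop {E : Set G} (A₀ A B : E) (γ : Path (Γ.vertex A₀) (Γ.vertex A₀)) : Prop :=
  ∃ (p : Path (Γ.vertex A₀) (Γ.vertex A)) (q : Path (Γ.vertex A) (Γ.vertex B))
    (r : Path (Γ.vertex B) (Γ.vertex A₀)),
    Γ.InHull p ∧ Γ.InHull q ∧ Γ.InHull r ∧ γ = (p.trans q).trans r

variable (Γ) in
/-- The fundamental group `π₁(X_E, A₀)` in which `[α][β]` is the class of the loop that runs along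
`α` first and then along `β`. Mathlib multiplies loops in the opposite order. -/
abbrev GlideGroup {E : Set G} (A₀ : E) : Type _ :=
  (FundamentalGroup (Γ.GlideComplex E) (Γ.vertex A₀))ᵐᵒᵖ

variable (Γ) in
/-- The class of a loop in `π₁(X_E, A₀)`. -/
def loopClass {E : Set G} {A₀ : E} (γ : Path (Γ.vertex A₀) (Γ.vertex A₀)) : Γ.GlideGroup A₀ :=
  MulOpposite.op (FundamentalGroup.fromPath (Path.Homotopic.Quotient.mk γ))

/-- The order of multiplication in `π₁(X_E, A₀)`. -/
theorem loopClass_trans {E : Set G} {A₀ : E} (γ δ : Path (Γ.vertex A₀) (Γ.vertex A₀)) :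
    Γ.loopClass (γ.trans δ) = Γ.loopClass γ * Γ.loopClass δ := rfl

end GlidingSystem

/-!
The group of `X_E` is computed from the cover of `X_E` by the open stars `St(A)` of its vertices
`A ∈ E`. These are open, and contractible by the homotheties centred at `A`
(`GlidingSystem.isSimplyConnected_star`), and a point common to several of them lies in a cube that
has all their centres among its vertices.

Write `P` for the presented group. The hull of `{A, B}` is a face of every cube with vertices `A`
and `B`, so all paths from `A` to `B` that run in such a cube are homotopic
(`GlidingSystem.IsEdge.homotopic`). The classes of these edge paths therefore satisfy the relations
of `P`, which gives a homomorphism `P → π₁(X_E, A₀)`, `GlidingSystem.edgeHom`.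

It is surjective: complete the final segments of a loop to loops at `A₀` by an edge path from `A₀`
to some `A` and a path in `St(A)`. Whether the result lies in the image does not depend on `A`,
since two segments from a point of `St(A) ∩ St(B)` to `A` and `B` form an edge path, and it is
locally constant in the starting time, since the stars are simply connected. This is
`fundamentalGroup_subgroup_eq_top`, a statement about simply connected open covers.

It is injective: the generators `y_{A,B}` form a `P`-valued cocycle on the cover by open stars,
which defines a covering of `X_E` with fiber `P`. Over a closed cell with vertex `A` this covering
has the sections that read `v * y_{A,C}` on `St(C)`. Hence the monodromy of any path from `A` to `B`
in a closed cell is right multiplication by `y_{A,B}` (`GlidingSystem.exists_transport`), so the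
monodromy of the image of `g ∈ P` is right multiplication by `g`. The same computation identifies
the class of every loop composed of three paths in hulls, with no need to lift these paths to
geometric cubes.
-/

/-! ### Coverings defined by cocycles -/

/-- The covering of `X` with discrete fiber `P` defined by a `P`-valued cocycle `g`, constant on
the intersections of members of an open cover `U`; the fibers are glued by right multiplication.
The function `k` selects a member of the cover around each point. -/
def cocycleCore {ι X P : Type*} [TopologicalSpace X] [Group P] [TopologicalSpace P]
    [DiscreteTopology P] (U : ι → Set X)
    (hU : ∀ i, IsOpen (U i)) (k : X → ι) (hk : ∀ x, x ∈ U (k x)) (g : ι → ι → P)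
    (hg : ∀ i j l, (U i ∩ U j ∩ U l).Nonempty → g i j * g j l = g i l) :
    FiberBundleCore ι X P where
  baseSet := U
  isOpen_baseSet := hU
  indexAt := k
  mem_baseSet_at := hk
  coordChange i j _ v := v * g i j
  coordChange_self i x hx v := by
    have := hg i i i ⟨x, ⟨hx, hx⟩, hx⟩
    rw [mul_eq_left.1 this, mul_one]
  continuousOn_coordChange i j :=
    ((continuous_of_discreteTopology (f := fun v : P => v * g i j)).comp
      continuous_snd).continuousOn
  coordChange_comp i j l x hx v := by rw [mul_assoc, hg i j l ⟨x, hx⟩]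

section

variable {ι X P : Type*} [TopologicalSpace X] [Group P] [TopologicalSpace P]
  [DiscreteTopology P] (U : ι → Set X)
  (hU : ∀ i, IsOpen (U i)) (k : X → ι) (hk : ∀ x, x ∈ U (k x)) (g : ι → ι → P)
  (hg : ∀ i j l, (U i ∩ U j ∩ U l).Nonempty → g i j * g j l = g i l)

theorem isCoveringMap_cocycleCore : IsCoveringMap (cocycleCore U hU k hk g hg).proj :=
  FiberBundle.isCoveringMap (E := (cocycleCore U hU k hk g hg).Fiber)

/-- A family `s` of constants compatible with the cocycle along a path is a section of the covering
over the path, so it computes the monodromy. -/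
theorem monodromy_cocycleCore {x y : X} (γ : Path x y) (s : ι → P)
    (hs : ∀ t i j, γ t ∈ U i → γ t ∈ U j → s i * g i j = s j) :
    (isCoveringMap_cocycleCore U hU k hk g hg).monodromy (.mk γ) ⟨⟨x, s (k x)⟩, rfl⟩ =
      ⟨⟨y, s (k y)⟩, rfl⟩ := by
  let Z := cocycleCore U hU k hk g hg
  let f : I → Z.TotalSpace := fun t => ⟨γ t, s (k (γ t))⟩
  have hf : Continuous f := by
    refine continuous_iff_continuousAt.2 fun t₀ => ?_
    rw [FiberBundle.continuousAt_totalSpace]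
    refine ⟨γ.continuous.continuousAt, ?_⟩
    refine (continuousAt_const (y := s (k (γ t₀)))).congr ?_
    filter_upwards [γ.continuous.continuousAt ((hU (k (γ t₀))).mem_nhds (hk (γ t₀)))] with t ht
    exact (hs t _ _ (hk _) ht).symm
  have hf' {t : I} {z : X} (h : γ t = z) : f t = ⟨z, s (k z)⟩ := by subst h; rfl
  have h0 : f 0 = ⟨x, s (k x)⟩ := hf' γ.source
  have h1 : f 1 = ⟨y, s (k y)⟩ := hf' γ.target
  have e := ((isCoveringMap_cocycleCore U hU k hk g hg).eq_liftPath_iff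
    (γ := γ.toContinuousMap) (e := ⟨x, s (k x)⟩) (γ_0 := γ.source) (Γ := f)).2 ⟨hf, rfl, h0⟩
  exact Subtype.ext ((congrFun e 1).symm.trans h1)

end

/-- The parallel transport of the covering defined by a cocycle, with all fibers identified
with `P` by means of the selected members of the cover. -/
theorem exists_parallel_transport {ι X P : Type*} [TopologicalSpace X] [Group P] {U : ι → Set X}
    (hU : ∀ i, IsOpen (U i)) {k : X → ι} (hk : ∀ x, x ∈ U (k x)) {g : ι → ι → P}
    (hg : ∀ i j l, (U i ∩ U j ∩ U l).Nonempty → g i j * g j l = g i l) :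
    ∃ M : ∀ {x y : X}, Path.Homotopic.Quotient x y → P → P,
      (∀ (x : X) (v : P), M (.refl x) v = v) ∧
      (∀ {x y z : X} (γ : Path.Homotopic.Quotient x y) (δ : Path.Homotopic.Quotient y z) (v : P),
        M (γ.trans δ) v = M δ (M γ v)) ∧
      ∀ {x y : X} (γ : Path x y) (s : ι → P),
        (∀ t i j, γ t ∈ U i → γ t ∈ U j → s i * g i j = s j) → M (.mk γ) (s (k x)) = s (k y) := by
  let _ : TopologicalSpace P := ⊥
  have _ : DiscreteTopology P := ⟨rfl⟩
  have cov := isCoveringMap_cocycleCore U hU k hk g hg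
  let Z := cocycleCore U hU k hk g hg
  let m (x : X) (v : P) : Z.proj ⁻¹' {x} := ⟨⟨x, v⟩, rfl⟩
  let r {x : X} (e : Z.proj ⁻¹' {x}) : P := e.1.2
  have eta {x : X} (e : Z.proj ⁻¹' {x}) : e = m x (r e) := by
    obtain ⟨⟨y, v⟩, rfl⟩ := e
    rfl
  exact ⟨fun {x y} γ v => r (cov.monodromy γ (m x v)),
    fun x v => congrArg r (congrFun cov.monodromy_refl (m x v)),
    fun {x y z} γ δ v => (congrArg r (cov.monodromy_trans_apply γ δ (m x v))).trans
      (congrArg (fun e => r (cov.monodromy δ e)) (eta _)),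
    fun {x y} γ s hs => congrArg r (monodromy_cocycleCore U hU k hk g hg γ s hs)⟩

/-! ### Generation of the fundamental group by a simply connected cover -/

theorem IsSimplyConnected.homotopic {X : Type*} [TopologicalSpace X] {U : Set X}
    (hU : IsSimplyConnected U) {x y : X} {p q : Path x y} (hp : ∀ t, p t ∈ U)
    (hq : ∀ t, q t ∈ U) : p.Homotopic q := by
  have := hU.simplyConnectedSpace
  have hx : x ∈ U := p.source ▸ hp 0
  have hy : y ∈ U := p.target ▸ hp 1
  let p' : Path (⟨x, hx⟩ : U) ⟨y, hy⟩ :=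
    ⟨⟨fun t => ⟨p t, hp t⟩, by fun_prop⟩, by simp, by simp⟩
  let q' : Path (⟨x, hx⟩ : U) ⟨y, hy⟩ :=
    ⟨⟨fun t => ⟨q t, hq t⟩, by fun_prop⟩, by simp, by simp⟩
  exact (SimplyConnectedSpace.paths_homotopic p' q').map ⟨Subtype.val, continuous_subtype_val⟩

/-- Let `X` be covered by simply connected open sets `U i` with points `v i`, joined to the base
point by paths `d i`. A subgroup of the fundamental group is everything if it contains, for each
point of each intersection `U i ∩ U j`, the loop that runs along `d i`, inside `U i` to that point,
inside `U j` to `v j`, and back along `d j`. -/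
theorem fundamentalGroup_subgroup_eq_top {ι X : Type*} [TopologicalSpace X] {U : ι → Set X}
    (hU : ∀ i, IsOpen (U i)) (hcov : ∀ x, ∃ i, x ∈ U i) (hsc : ∀ i, IsSimplyConnected (U i))
    {v : ι → X} (hv : ∀ i, v i ∈ U i) {i₀ : ι} (d : ∀ i, Path (v i₀) (v i))
    (hd : (d i₀).Homotopic (Path.refl _)) (H : Subgroup (FundamentalGroup X (v i₀)))
    (hH : ∀ x i j, x ∈ U i → x ∈ U j → ∃ (p : Path (v i) x) (q : Path (v j) x),
      (∀ t, p t ∈ U i) ∧ (∀ t, q t ∈ U j) ∧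
        FundamentalGroup.fromPath (.mk (((d i).trans p).trans ((d j).trans q).symm)) ∈ H) :
    H = ⊤ := by
  -- the paths `δ` to the base point that, completed to a loop by a path inside a member of the
  -- cover, give an element of `H`
  let Good (y : X) (δ : Path y (v i₀)) : Prop := ∃ (i : ι) (q : Path (v i) y),
    (∀ t, q t ∈ U i) ∧ FundamentalGroup.fromPath (.mk (((d i).trans q).trans δ)) ∈ H
  -- by the hypothesis on `H`, the choice of the path in the cover does not matter
  have good_iff {y : X} {δ : Path y (v i₀)} (h : Good y δ) (j : ι) (q' : Path (v j) y)
      (hq' : ∀ t, q' t ∈ U j) :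
      FundamentalGroup.fromPath (.mk (((d j).trans q').trans δ)) ∈ H := by
    obtain ⟨i, q, hq, hm⟩ := h
    obtain ⟨p, p', hp, hp', hm'⟩ := hH y j i (by simpa using hq' 1) (by simpa using hq 1)
    have e : (Path.Homotopic.Quotient.mk p) = .mk q' :=
      Path.Homotopic.Quotient.eq.2 ((hsc j).homotopic hp hq')
    have e' : (Path.Homotopic.Quotient.mk p') = .mk q :=
      Path.Homotopic.Quotient.eq.2 ((hsc i).homotopic hp' hq)
    convert H.mul_mem hm hm' using 1
    rw [FundamentalGroup.mul_def]
    simp only [Path.Homotopic.Quotient.mk_trans, Path.Homotopic.Quotient.mk_symm, e, e',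
      FundamentalGroup.fromPath, FundamentalGroup.fromArrow]
    rw [Path.Homotopic.Quotient.trans_assoc _ _ (Path.Homotopic.Quotient.trans _ _),
      ← Path.Homotopic.Quotient.trans_assoc (Path.Homotopic.Quotient.symm _),
      Path.Homotopic.Quotient.symm_trans, Path.Homotopic.Quotient.refl_trans]
  have good_trans {y y' : X} {δ : Path y (v i₀)} (h : Good y δ) (i : ι) (η : Path y' y)
      (hη : ∀ t, η t ∈ U i) : Good y' (η.trans δ) := by
    have hy' : y' ∈ U i := by simpa using hη 0
    obtain ⟨q, -, hq, -⟩ := hH y' i i hy' hy'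
    have := good_iff h i (q.trans η) fun t => by
      rw [Path.trans_apply]; split_ifs; exacts [hq _, hη _]
    refine ⟨i, q, hq, ?_⟩
    simpa only [Path.Homotopic.Quotient.mk_trans, Path.Homotopic.Quotient.trans_assoc] using this
  have good_congr {y : X} {δ δ' : Path y (v i₀)} (e : δ.Homotopic δ') (h : Good y δ) :
      Good y δ' := by
    obtain ⟨i, q, hq, hm⟩ := h
    refine ⟨i, q, hq, ?_⟩
    rw [← Path.Homotopic.Quotient.eq] at e
    simpa only [Path.Homotopic.Quotient.mk_trans, e] using hm
  have good_refl : Good _ (Path.refl (v i₀)) := by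
    refine ⟨i₀, Path.refl _, fun _ => hv i₀, ?_⟩
    simp only [Path.Homotopic.Quotient.mk_trans, Path.Homotopic.Quotient.eq.2 hd,
      Path.Homotopic.Quotient.mk_refl, Path.Homotopic.Quotient.refl_trans]
    exact H.one_mem
  refine (Subgroup.eq_top_iff' H).2 fun g => ?_
  obtain ⟨γ, rfl⟩ := Path.Homotopic.Quotient.mk_surjective g
  -- goodness of the final segment of `γ` that starts at time `t` is a clopen condition on `t`
  let tail (t : I) : Path (γ t) (v i₀) := (γ.subpath t 1).cast rfl γ.target.symm
  have step (t : I) : ∃ V ∈ nhds t, ∀ a ∈ V, ∀ b ∈ V, Good _ (tail a) → Good _ (tail b) := by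
    obtain ⟨i, hi⟩ := hcov (γ t)
    obtain ⟨V, hV, hc, hVU⟩ : ∃ V ∈ nhds t, V.OrdConnected ∧ V ⊆ γ ⁻¹' U i := by
      obtain ⟨ε, hε, h⟩ := Metric.mem_nhds_iff.1
        (γ.continuous.continuousAt ((hU i).mem_nhds hi))
      refine ⟨Metric.ball t ε, Metric.ball_mem_nhds t hε, ⟨fun a ha b hb c hc => ?_⟩, h⟩
      have h1 : (a : ℝ) ≤ c := hc.1
      have h2 : (c : ℝ) ≤ b := hc.2
      rw [Metric.mem_ball, Subtype.dist_eq, Real.dist_eq, abs_lt] at *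
      constructor <;> linarith
    refine ⟨V, hV, fun a ha b hb h => ?_⟩
    refine good_congr ?_ (good_trans h i (γ.subpath b a) fun s => ?_)
    · exact ⟨(Path.Homotopy.subpathTransSubpath γ b a 1).pathCast rfl γ.target.symm⟩
    · have : γ.subpath b a s ∈ γ '' Set.uIcc b a := by
        rw [← Path.range_subpath]; exact Set.mem_range_self s
      obtain ⟨r, hr, e⟩ := this
      rw [← e]
      exact hVU (hc.uIcc_subset hb ha hr)
  have hclopen : IsClopen {t | Good _ (tail t)} := by
    constructor
    · rw [← isOpen_compl_iff, isOpen_iff_mem_nhds]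
      intro t ht
      obtain ⟨V, hV, h⟩ := step t
      exact Filter.mem_of_superset hV fun a ha hg => ht (h a ha t (mem_of_mem_nhds hV) hg)
    · rw [isOpen_iff_mem_nhds]
      intro t ht
      obtain ⟨V, hV, h⟩ := step t
      exact Filter.mem_of_superset hV fun a ha => h t (mem_of_mem_nhds hV) a ha ht
  have cast_good {x x' : X} (e : x = x') (δ : Path x (v i₀)) :
      Good x δ ↔ Good x' (δ.cast e.symm rfl) := by
    subst e; rfl
  have h1 : Good _ (tail 1) := by
    refine (cast_good γ.target _).2 ?_
    convert good_refl using 1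
    ext t
    simp [tail]
  have h0 : Good _ (tail 0) := (hclopen.eq_univ ⟨1, h1⟩).ge (Set.mem_univ (0 : I))
  have h : Good _ γ := by
    have := (cast_good γ.source _).1 h0
    convert this using 1
    ext t
    simp [tail]
  have := good_iff h i₀ (Path.refl _) fun _ => hv i₀
  simpa only [Path.Homotopic.Quotient.mk_trans, Path.Homotopic.Quotient.eq.2 hd,
      Path.Homotopic.Quotient.mk_refl, Path.Homotopic.Quotient.refl_trans] using this

namespace GlidingSystem

variable {G : Type*} [Group G] {Γ : GlidingSystem G} {E : Set G}

/-! ### Vertices of based cubes -/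

open Classical in
/-- The subset `T` of the glides of a based cube `(A, S)` such that the given vertex is `[T]A`
(empty if the given element is not a vertex). -/
noncomputable def BasedCube.sub (c : Γ.BasedCube) (A : G) : Finset G :=
  if h : A ∈ c.vertices then h.choose else ∅

theorem BasedCube.sub_subset (c : Γ.BasedCube) (A : G) : c.sub A ⊆ c.dirs := by
  unfold sub
  split_ifs with h
  · exact h.choose_spec.choose
  · exact Finset.empty_subset _

theorem BasedCube.eq_bracket_sub {c : Γ.BasedCube} {A : G} (h : A ∈ c.vertices) :
    A = bracket (c.sub A) (c.indep_of_subset (c.sub_subset A)) * c.base := by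
  have e : c.sub A = h.choose := dif_pos h
  rw [bracket_congr _ (c.indep_of_subset h.choose_spec.choose) e]
  exact h.choose_spec.choose_spec

theorem BasedCube.sub_eq {c : Γ.BasedCube} {A : G} {T : Finset G} (hT : T ⊆ c.dirs)
    (h : A = bracket T (c.indep_of_subset hT) * c.base) : c.sub A = T := by
  have hA : A ∈ c.vertices := ⟨T, hT, h⟩
  obtain ⟨hS, hc⟩ := c.cubic
  by_contra hne
  exact hc _ _ (c.sub_subset A) hT hne (mul_right_cancel ((eq_bracket_sub hA).symm.trans h))

/-- The subset `T` with `[T]A` a given vertex, seen from another base vertex: membership is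
unchanged in the directions that are kept and reversed in those that are inverted. -/
theorem BasedCube.sub_rebase {c c' : Γ.BasedCube} {U : Finset G} (hU : U ⊆ c.dirs)
    (hb : c'.base = bracket U (c.indep_of_subset hU) * c.base) (hd : c'.dirs = flip c.dirs U)
    {A : G} (hA : A ∈ c.vertices) :
    (∀ s ∈ c.dirs, s ∉ U → (s ∈ c'.sub A ↔ s ∈ c.sub A)) ∧
      ∀ u ∈ U, (u⁻¹ ∈ c'.sub A ↔ u ∉ c.sub A) := by
  classical
  have key : ∀ s ∈ c.dirs, ∀ t ∈ c.dirs, s = t⁻¹ → s = t :=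
    fun s hs t ht h => c.cubic.isIndep.inv_eq_self hs ht h
  obtain ⟨T, hT, hA'⟩ := hA
  rw [sub_eq hT hA']
  have hV : (T \ U) ∪ (U \ T).image (·⁻¹) ⊆ c'.dirs := by
    intro x hx
    rw [hd, mem_flip]
    simp only [Finset.mem_union, Finset.mem_sdiff, Finset.mem_image] at hx
    rcases hx with hx | ⟨t, ht, rfl⟩
    · exact .inl ⟨hT hx.1, hx.2⟩
    · exact .inr ⟨t, ht.1, rfl⟩
  have hdj : Disjoint (T \ U) ((U \ T).image (·⁻¹)) := by
    rw [Finset.disjoint_left]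
    intro x hx hx'
    simp only [Finset.mem_sdiff, Finset.mem_image] at hx hx'
    obtain ⟨t, ht, rfl⟩ := hx'
    have h2 := key _ (hT hx.1) t (hU ht.1) rfl
    grind
  -- the vertex is reached from the new base by undoing `U \ T` and adding `T \ U`
  have e : c'.sub A = (T \ U) ∪ (U \ T).image (·⁻¹) := by
    refine sub_eq hV ?_
    rw [hb, ← mul_assoc, bracket_flip c.cubic.isIndep hU hT _ hdj]
    exact hA'
  rw [e]
  constructor
  · intro s hs hsU
    simp only [Finset.mem_union, Finset.mem_sdiff, Finset.mem_image]
    constructor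
    · rintro (h | ⟨t, ht, rfl⟩)
      · exact h.1
      · have h2 := key _ hs t (hU ht.1) rfl
        grind
    · exact fun h => .inl ⟨h, hsU⟩
  · intro u hu
    simp only [Finset.mem_union, Finset.mem_sdiff, Finset.mem_image, inv_inj, exists_eq_right]
    constructor
    · rintro (h | h)
      · have h2 := key _ (hT h.1) u (hU hu) rfl
        grind
      · exact h.2
    · exact fun h => .inr ⟨hu, h⟩

theorem IsIndep.flip {S T : Finset G} (hS : Γ.IsIndep S) (hT : T ⊆ S) :
    Γ.IsIndep (flip S T) := by
  have inv_right : ∀ s t, (s, t) ∈ Γ.indep → (s, t⁻¹) ∈ Γ.indep := fun s t h =>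
    Γ.symm _ _ (Γ.inv_left _ _ (Γ.symm _ _ h))
  constructor
  · intro x hx
    rcases mem_flip.1 hx with h | ⟨t, ht, rfl⟩
    · exact hS.1 h.1
    · exact Γ.inv_mem _ (hS.1 (hT ht))
  · intro x hx y hy hxy
    rcases mem_flip.1 hx with h | ⟨t, ht, rfl⟩ <;> rcases mem_flip.1 hy with h' | ⟨t', ht', rfl⟩
    · exact hS.2 h.1 h'.1 hxy
    · exact inv_right _ _ (hS.2 h.1 (hT ht') (by rintro rfl; exact h.2 ht'))
    · exact Γ.inv_left _ _ (hS.2 (hT ht) h'.1 (by rintro rfl; exact h'.2 ht))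
    · exact Γ.inv_left _ _ (inv_right _ _ (hS.2 (hT ht) (hT ht') (by rintro rfl; exact hxy rfl)))

theorem IsCubic.flip {S T : Finset G} (hS : Γ.IsCubic S) (hT : T ⊆ S) :
    Γ.IsCubic (flip S T) := by
  classical
  obtain ⟨hi, hc⟩ := hS
  refine ⟨hi.flip hT, fun V₁ V₂ h₁ h₂ hne heq => hne ?_⟩
  obtain ⟨U₁, hU₁, rfl, hd₁, -⟩ := exists_subset_flip hi hT h₁
  obtain ⟨U₂, hU₂, rfl, hd₂, -⟩ := exists_subset_flip hi hT h₂
  have e := congrArg (· * bracket T (hi.subset hT)) heq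
  simp only [bracket_flip hi hT hU₁ _ hd₁, bracket_flip hi hT hU₂ _ hd₂] at e
  by_contra hne'
  exact hc U₁ U₂ hU₁ hU₂ (by rintro rfl; exact hne' rfl) e

/-- The based cube equivalent to `c` with base vertex `[T]A`, where `A` is the base of `c`. -/
noncomputable def BasedCube.rebase (c : Γ.BasedCube) (T : Finset G) (hT : T ⊆ c.dirs) :
    Γ.BasedCube :=
  ⟨bracket T (c.indep_of_subset hT) * c.base, flip c.dirs T, c.cubic.flip hT⟩

theorem BasedCube.equiv_rebase (c : Γ.BasedCube) (T : Finset G) (hT : T ⊆ c.dirs) :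
    c.Equiv (c.rebase T hT) :=
  ⟨T, hT, rfl, rfl⟩

theorem BasedCube.Equiv.vertices_eq {c c' : Γ.BasedCube} (h : c.Equiv c') :
    c.vertices = c'.vertices :=
  (BasedCube.Equiv.symm h).vertices_subset.antisymm h.vertices_subset

theorem BasedCube.mem_vertices_of_subset {c c' : Γ.BasedCube} (hb : c.base = c'.base)
    (hd : c.dirs ⊆ c'.dirs) {A : G} (hA : A ∈ c.vertices) :
    A ∈ c'.vertices ∧ c'.sub A = c.sub A := by
  have h := eq_bracket_sub hA
  rw [hb] at h
  exact ⟨⟨_, (c.sub_subset A).trans hd, h⟩, sub_eq ((c.sub_subset A).trans hd) h⟩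

theorem BasedCube.mem_vertices_of_sub_subset {c c' : Γ.BasedCube} (hb : c.base = c'.base)
    {A : G} (hA : A ∈ c'.vertices) (h : c'.sub A ⊆ c.dirs) : A ∈ c.vertices :=
  ⟨c'.sub A, h, by rw [hb]; exact eq_bracket_sub hA⟩

open Classical in
/-- The coordinates of a point of a geometric cube read from the vertex `A`, reversed so that all
of them are `1` at `A` and those of the opposite vertex are `0`. -/
noncomputable def BasedCube.agree (c : Γ.BasedCube) (A : G) (x : c.dirs → I) (s : c.dirs) : I :=
  if s.1 ∈ c.sub A then x s else σ (x s)

theorem BasedCube.agree_of_mem {c : Γ.BasedCube} {A : G} {s : c.dirs} (hs : s.1 ∈ c.sub A)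
    (x : c.dirs → I) : c.agree A x s = x s :=
  if_pos hs

theorem BasedCube.agree_of_notMem {c : Γ.BasedCube} {A : G} {s : c.dirs} (hs : s.1 ∉ c.sub A)
    (x : c.dirs → I) : c.agree A x s = σ (x s) :=
  if_neg hs

theorem BasedCube.agree_eq_agree {c c' : Γ.BasedCube} {A : G} {s : c.dirs} {s' : c'.dirs}
    (h : s.1 ∈ c.sub A ↔ s'.1 ∈ c'.sub A) {x : c.dirs → I} {x' : c'.dirs → I}
    (hx : x s = x' s') : c.agree A x s = c'.agree A x' s' := by
  by_cases hs : s.1 ∈ c.sub A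
  · rw [agree_of_mem hs, agree_of_mem (h.1 hs), hx]
  · rw [agree_of_notMem hs, agree_of_notMem (mt h.2 hs), hx]

theorem BasedCube.agree_eq_agree_symm {c c' : Γ.BasedCube} {A : G} {s : c.dirs} {s' : c'.dirs}
    (h : s'.1 ∈ c'.sub A ↔ s.1 ∉ c.sub A) {x : c.dirs → I} {x' : c'.dirs → I}
    (hx : x' s' = σ (x s)) : c.agree A x s = c'.agree A x' s' := by
  by_cases hs : s.1 ∈ c.sub A
  · rw [agree_of_mem hs, agree_of_notMem (fun h' => h.1 h' hs), hx, unitInterval.symm_symm]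
  · rw [agree_of_notMem hs, agree_of_mem (h.2 hs), hx]

/-- A condition on a point of a geometric cube: `A` is a vertex of the cube and all coordinates of
the point, read from `A`, satisfy `P`. For `P` true at `1` and false at `0` it is invariant under
the identifications that define the glide complex. -/
def Near (P : I → Prop) (A : G) (z : Γ.CubePoint E) : Prop :=
  A ∈ z.1.1.vertices ∧ ∀ s, P (z.1.1.agree A z.2 s)

theorem Glue.near_iff {P : I → Prop} (h1 : P 1) (h0 : ¬ P 0) (A : G) {z z' : Γ.CubePoint E}
    (h : Glue E z z') : Near P A z ↔ Near P A z' := by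
  cases h with
  | face c c' x x' hbase hdirs hx hx0 =>
    constructor
    · rintro ⟨hA, h⟩
      obtain ⟨hA', e⟩ := BasedCube.mem_vertices_of_subset hbase hdirs hA
      refine ⟨hA', fun s => ?_⟩
      by_cases hs : s.1 ∈ c.1.dirs
      · exact BasedCube.agree_eq_agree (by rw [e]) (hx s.1 hs) ▸ h ⟨s.1, hs⟩
      · change P (c'.1.agree A x' s)
        rw [BasedCube.agree_of_notMem (by rw [e]; exact fun h => hs (c.1.sub_subset A h)),
          hx0 s hs, unitInterval.symm_zero]
        exact h1
    · rintro ⟨hA', h⟩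
      -- a coordinate of a direction outside the face vanishes, so that direction is not used at `A`
      have hsub : c'.1.sub A ⊆ c.1.dirs := by
        intro s hs
        by_contra hsc
        have hP : P (c'.1.agree A x' ⟨s, c'.1.sub_subset A hs⟩) := h _
        rw [BasedCube.agree_of_mem hs, hx0 _ hsc] at hP
        exact h0 hP
      have hA := BasedCube.mem_vertices_of_sub_subset hbase hA' hsub
      obtain ⟨-, e⟩ := BasedCube.mem_vertices_of_subset hbase hdirs hA
      exact ⟨hA, fun s => BasedCube.agree_eq_agree (by rw [e]) (hx s.1 s.2) ▸ h ⟨s.1, hdirs s.2⟩⟩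
  | rebase c c' x x' T hT hbase hdirs hx hxT =>
    have hv : c.1.vertices = c'.1.vertices := BasedCube.Equiv.vertices_eq ⟨T, hT, hbase, hdirs⟩
    refine ⟨fun h => ⟨hv ▸ h.1, fun s => ?_⟩, fun h => ⟨hv ▸ h.1, fun s => ?_⟩⟩
    · obtain ⟨hm, hm'⟩ := BasedCube.sub_rebase hT hbase hdirs h.1
      rcases mem_flip.1 (hdirs ▸ s.2 : s.1 ∈ flip c.1.dirs T) with hs | ⟨t, ht, hts⟩
      · exact BasedCube.agree_eq_agree (hm _ hs.1 hs.2).symm (hx s.1 hs.1 s.2 hs.2).symm ▸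
          h.2 ⟨s.1, hs.1⟩
      · obtain ⟨s, hs⟩ := s
        subst hts
        exact BasedCube.agree_eq_agree_symm (hm' t ht) (hxT t ht hs) ▸ h.2 ⟨t, hT ht⟩
    · obtain ⟨hm, hm'⟩ := BasedCube.sub_rebase hT hbase hdirs (hv ▸ h.1 : A ∈ c.1.vertices)
      by_cases hs : s.1 ∈ T
      · have hs' : s.1⁻¹ ∈ c'.1.dirs := hdirs ▸ mem_flip.2 (.inr ⟨_, hs, rfl⟩)
        exact BasedCube.agree_eq_agree_symm (hm' _ hs) (hxT _ hs hs') ▸ h.2 ⟨_, hs'⟩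
      · have hs' : s.1 ∈ c'.1.dirs := hdirs ▸ mem_flip.2 (.inl ⟨s.2, hs⟩)
        exact BasedCube.agree_eq_agree (hm _ s.2 hs) (hx _ s.2 hs' hs) ▸ h.2 ⟨_, hs'⟩

/-! ### Open stars -/

open Topology

/-- The characteristic map of a based cube in `E`. -/
def cubeMap (c : {c : Γ.BasedCube // c.vertices ⊆ E}) : C(c.1.dirs → I, Γ.GlideComplex E) where
  toFun x := Quot.mk _ ⟨c, x⟩
  continuous_toFun := continuous_quot_mk.comp continuous_sigmaMk

theorem exists_eq_cubeMap (p : Γ.GlideComplex E) : ∃ c x, p = cubeMap c x := by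
  obtain ⟨⟨c, x⟩, rfl⟩ := Quot.exists_rep p
  exact ⟨c, x, rfl⟩

theorem BasedCube.continuous_agree (c : Γ.BasedCube) (A : G) (s : c.dirs) :
    Continuous fun x : c.dirs → I => c.agree A x s := by
  unfold BasedCube.agree
  split_ifs
  · exact continuous_apply s
  · exact unitInterval.continuous_symm.comp (continuous_apply s)

variable (Γ) in
/-- The open star of `A`: the points of closed cells with vertex `A` that lie on no face of the
cell that misses `A`. -/
def star (E : Set G) (A : G) : Set (Γ.GlideComplex E) :=
  {p | Quot.lift (Near (· ≠ 0) A)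
    (fun _ _ h => propext (Glue.near_iff (P := (· ≠ 0)) one_ne_zero (by simp) A h)) p}

theorem cubeMap_mem_star {A : G} {c : {c : Γ.BasedCube // c.vertices ⊆ E}} {x : c.1.dirs → I} :
    cubeMap c x ∈ Γ.star E A ↔ A ∈ c.1.vertices ∧ ∀ s, c.1.agree A x s ≠ 0 :=
  Iff.rfl

theorem isQuotientMap_mk :
    IsQuotientMap (Quot.mk (Glue E) : Γ.CubePoint E → Γ.GlideComplex E) :=
  isQuotientMap_quot_mk

theorem isOpen_star (A : G) : IsOpen (Γ.star E A) := by
  refine isQuotientMap_mk.isOpen_preimage.1 (isOpen_sigma_iff.2 ?_)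
  intro c
  change IsOpen {x : c.1.dirs → I | A ∈ c.1.vertices ∧ ∀ s, c.1.agree A x s ≠ 0}
  by_cases hA : A ∈ c.1.vertices
  · simp only [hA, true_and, Set.ofPred_forall]
    exact isOpen_iInter_of_finite fun s => isOpen_ne.preimage (c.1.continuous_agree A s)
  · simp [hA]

/-- The point of a geometric cube at the vertex `A`. -/
noncomputable def BasedCube.corner (c : Γ.BasedCube) (A : G) (s : c.dirs) : I :=
  open Classical in if s.1 ∈ c.sub A then 1 else 0

theorem BasedCube.eq_corner {c : Γ.BasedCube} {A : G} {x : c.dirs → I}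
    (h : ∀ s, c.agree A x s = 1) : x = c.corner A := by
  funext s
  have := h s
  by_cases hs : s.1 ∈ c.sub A <;> simpa [agree, corner, hs] using this

theorem cubeMap_corner (c : {c : Γ.BasedCube // c.vertices ⊆ E}) {A : E}
    (hA : (A : G) ∈ c.1.vertices) : cubeMap c (c.1.corner A) = Γ.vertex A := by
  let c' : {c : Γ.BasedCube // c.vertices ⊆ E} :=
    ⟨c.1.rebase _ (c.1.sub_subset A), (c.1.equiv_rebase _ _).vertices_subset.trans c.2⟩
  have hb : (A : G) = c'.1.base := BasedCube.eq_bracket_sub hA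
  have h1 : cubeMap c (c.1.corner A) = cubeMap c' fun _ => 0 := by
    refine Quot.sound (Glue.rebase c c' _ _ _ (c.1.sub_subset A) rfl rfl ?_ ?_)
    · intro s hs hs' h
      exact (if_neg h).symm
    · intro t ht ht'
      rw [BasedCube.corner, if_pos ht, unitInterval.symm_one]
  rw [h1]
  exact (Quot.sound (Glue.face _ c' _ _ hb (Finset.empty_subset _)
    (fun s hs => absurd hs (Finset.notMem_empty s)) fun _ _ => rfl)).symm

/-- The characteristic map of a cube takes the value `A` only at the corner `A`: the condition that
all coordinates read from `A` be `1` is invariant under the identifications. -/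
theorem eq_corner_of_cubeMap_eq {c : {c : Γ.BasedCube // c.vertices ⊆ E}} {A : E}
    {x : c.1.dirs → I} (h : cubeMap c x = Γ.vertex A) :
    (A : G) ∈ c.1.vertices ∧ x = c.1.corner A := by
  have key := congrArg (Quot.lift (Near (E := E) (Γ := Γ) (· = 1) (A : G))
    (fun _ _ h => propext (Glue.near_iff (P := (· = 1)) rfl (by simp) (A : G) h))) h
  have hv : Near (Γ := Γ) (E := E) (· = 1) (A : G)
      ⟨⟨Γ.zeroCube A, by rw [zeroCube_vertices]; exact Set.singleton_subset_iff.2 A.2⟩,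
        fun _ => 0⟩ :=
    ⟨by rw [zeroCube_vertices]; rfl, fun s => absurd s.2 (Finset.notMem_empty _)⟩
  have : Near (· = 1) (A : G) (⟨c, x⟩ : Γ.CubePoint E) := key.mpr hv
  exact ⟨this.1, BasedCube.eq_corner this.2⟩

theorem vertex_mem_star {A : E} {B : G} : Γ.vertex A ∈ Γ.star E B ↔ B = A := by
  constructor
  · intro h
    have : B ∈ (Γ.zeroCube (A : G)).vertices := h.1
    rwa [zeroCube_vertices] at this
  · rintro rfl
    exact ⟨by rw [zeroCube_vertices]; rfl, fun s => absurd s.2 (Finset.notMem_empty _)⟩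

theorem exists_mem_star (p : Γ.GlideComplex E) : ∃ A : E, p ∈ Γ.star E A := by
  classical
  obtain ⟨c, x, rfl⟩ := exists_eq_cubeMap p
  -- the vertex of the cube at which the coordinates equal to `1` are `1` and the others `0`
  let T : Finset G := c.1.dirs.filter fun s => ∃ hs : s ∈ c.1.dirs, x ⟨s, hs⟩ = 1
  have hT : T ⊆ c.1.dirs := Finset.filter_subset _ _
  have hA : bracket T (c.1.indep_of_subset hT) * c.1.base ∈ c.1.vertices := ⟨T, hT, rfl⟩
  refine ⟨⟨_, c.2 hA⟩, hA, fun s => ?_⟩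
  have e : c.1.sub (bracket T (c.1.indep_of_subset hT) * c.1.base) = T := BasedCube.sub_eq hT rfl
  by_cases hs : s.1 ∈ T
  · rw [BasedCube.agree_of_mem (by rw [e]; exact hs)]
    obtain ⟨-, h, h1⟩ := Finset.mem_filter.1 hs
    change x ⟨s.1, h⟩ ≠ 0
    exact h1.symm ▸ one_ne_zero
  · rw [BasedCube.agree_of_notMem (by rw [e]; exact hs)]
    intro h0
    exact hs (Finset.mem_filter.2 ⟨s.2, s.2, unitInterval.symm_eq_zero.1 h0⟩)

/-! ### Contracting the open stars -/

/-- The homothety of a geometric cube with centre the vertex `A` and ratio `t`. -/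
noncomputable def BasedCube.shrink (c : Γ.BasedCube) (A : G) (x : c.dirs → I) (t : I)
    (s : c.dirs) : I :=
  open Classical in if s.1 ∈ c.sub A then σ (t * σ (x s)) else t * x s

theorem BasedCube.agree_shrink (c : Γ.BasedCube) (A : G) (x : c.dirs → I) (t : I) (s : c.dirs) :
    c.agree A (c.shrink A x t) s = σ (t * σ (c.agree A x s)) := by
  by_cases hs : s.1 ∈ c.sub A <;> simp [agree, shrink, hs]

theorem BasedCube.shrink_one (c : Γ.BasedCube) (A : G) (x : c.dirs → I) :
    c.shrink A x 1 = x := by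
  funext s
  by_cases hs : s.1 ∈ c.sub A <;> simp [shrink, hs]

theorem BasedCube.shrink_zero (c : Γ.BasedCube) (A : G) (x : c.dirs → I) :
    c.shrink A x 0 = c.corner A := by
  funext s
  by_cases hs : s.1 ∈ c.sub A <;> simp [shrink, corner, hs]

theorem BasedCube.continuous_shrink (c : Γ.BasedCube) (A : G) :
    Continuous fun q : (c.dirs → I) × I => c.shrink A q.1 q.2 := by
  refine continuous_pi fun s => ?_
  unfold shrink
  have hs : Continuous fun q : (c.dirs → I) × I => q.1 s := (continuous_apply s).comp continuous_fst
  split_ifs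
  · exact unitInterval.continuous_symm.comp
      (continuous_snd.mul (unitInterval.continuous_symm.comp hs))
  · exact continuous_snd.mul hs

instance BasedCube.contractibleSpace (c : Γ.BasedCube) : ContractibleSpace (c.dirs → I) := by
  rw [contractible_iff_id_nullhomotopic]
  refine ⟨c.corner c.base, ⟨⟨⟨fun q => c.shrink c.base q.2 (σ q.1), ?_⟩, fun x => ?_, fun x => ?_⟩⟩⟩
  · exact (c.continuous_shrink _).comp
      (continuous_snd.prodMk (unitInterval.continuous_symm.comp continuous_fst))
  · simp [shrink_one]
  · simp [shrink_zero]

/-- The coordinates of a homothetic image, read from the centre, do not vanish if the original ones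
do not. -/
theorem symm_mul_symm_ne_zero {a : I} (ha : a ≠ 0) (t : I) : σ (t * σ a) ≠ 0 := by
  rw [Ne, unitInterval.symm_eq_zero, ← Subtype.coe_inj]
  have h0 : (0 : ℝ) < a := unitInterval.pos_iff_ne_zero.2 ha
  have h1 : (t : ℝ) ≤ 1 := t.2.2
  have h2 : (a : ℝ) ≤ 1 := a.2.2
  simp only [Set.Icc.coe_mul, unitInterval.coe_symm_eq, Set.Icc.coe_one]
  nlinarith [mul_nonneg (sub_nonneg.2 h1) (sub_nonneg.2 h2)]

/-- Homotheties respect the identifications of points of geometric cubes. -/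
theorem Glue.shrink {A : G} {z z' : Γ.CubePoint E} (h : Glue E z z') (hA : A ∈ z.1.1.vertices)
    (t : I) :
    Glue E ⟨z.1, z.1.1.shrink A z.2 t⟩ ⟨z'.1, z'.1.1.shrink A z'.2 t⟩ := by
  cases h with
  | face c c' x x' hbase hdirs hx hx0 =>
    obtain ⟨-, e⟩ := BasedCube.mem_vertices_of_subset hbase hdirs hA
    refine Glue.face c c' _ _ hbase hdirs (fun s hs => ?_) fun s hs => ?_
    · by_cases h : s ∈ c.1.sub A
      · simp only [BasedCube.shrink, e, h, if_true, hx]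
      · simp only [BasedCube.shrink, e, h, if_false, hx]
    · have : s.1 ∉ c'.1.sub A := by rw [e]; exact fun h => hs (c.1.sub_subset A h)
      simp only [BasedCube.shrink, this, if_false, hx0 s hs, mul_zero]
  | rebase c c' x x' T hT hbase hdirs hx hxT =>
    obtain ⟨hm, hm'⟩ := BasedCube.sub_rebase hT hbase hdirs hA
    refine Glue.rebase c c' _ _ T hT hbase hdirs (fun s hs hs' hsT => ?_) fun s hs hs' => ?_
    · by_cases h : s ∈ c.1.sub A
      · simp only [BasedCube.shrink, hm s hs hsT, h, if_true, hx s hs hs' hsT]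
      · simp only [BasedCube.shrink, hm s hs hsT, h, if_false, hx s hs hs' hsT]
    · by_cases h : s ∈ c.1.sub A
      · simp only [BasedCube.shrink, hm' s hs, h, if_true, not_true, if_false, hxT s hs hs',
          unitInterval.symm_symm]
      · simp only [BasedCube.shrink, hm' s hs, h, if_true, not_false_iff, if_false, hxT s hs hs',
          unitInterval.symm_symm]

open Classical in
/-- The homotheties of the open star of `A` with centre `A`, extended arbitrarily to `X_E`. -/
noncomputable def contract (A : G) : Γ.GlideComplex E → I → Γ.GlideComplex E :=
  Quot.lift (fun z t => if Near (· ≠ 0) A z then cubeMap z.1 (z.1.1.shrink A z.2 t)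
    else cubeMap z.1 z.2) fun z z' h => by
      have e := Glue.near_iff (P := (· ≠ 0)) one_ne_zero (by simp) A h
      funext t
      by_cases hn : Near (· ≠ 0) A z
      · rw [if_pos hn, if_pos (e.1 hn)]
        exact Quot.sound (h.shrink hn.1 t)
      · rw [if_neg hn, if_neg (mt e.2 hn)]
        exact Quot.sound h

theorem contract_cubeMap {A : G} {c : {c : Γ.BasedCube // c.vertices ⊆ E}} {x : c.1.dirs → I}
    (h : cubeMap c x ∈ Γ.star E A) (t : I) :
    contract A (cubeMap c x) t = cubeMap c (c.1.shrink A x t) :=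
  if_pos h

theorem cubeMap_shrink_mem_star {A : G} {c : {c : Γ.BasedCube // c.vertices ⊆ E}}
    {x : c.1.dirs → I} (h : cubeMap c x ∈ Γ.star E A) (t : I) :
    cubeMap c (c.1.shrink A x t) ∈ Γ.star E A := by
  refine cubeMap_mem_star.2 ⟨h.1, fun s => ?_⟩
  rw [BasedCube.agree_shrink]
  exact symm_mul_symm_ne_zero (h.2 s) t

theorem contract_mem_star {A : G} {p : Γ.GlideComplex E} (h : p ∈ Γ.star E A) (t : I) :
    contract A p t ∈ Γ.star E A := by
  obtain ⟨c, x, rfl⟩ := exists_eq_cubeMap p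
  rw [contract_cubeMap h]
  exact cubeMap_shrink_mem_star h t

/-- Joint continuity is checked on the disjoint union of the cubes: the quotient map restricted to
the open star stays a quotient map after taking the product with the locally compact space `I`. -/
theorem continuous_contract (A : G) :
    Continuous fun q : Γ.star E A × I => contract A (q.1 : Γ.GlideComplex E) q.2 := by
  have hq := isQuotientMap_mk.restrictPreimage_isOpen (isOpen_star (Γ := Γ) (E := E) A)
  refine hq.continuous_lift_prod_left ?_
  let f : Γ.CubePoint E × I → Γ.CubePoint E := fun q => ⟨q.1.1, q.1.1.1.shrink A q.1.2 q.2⟩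
  have hf : Continuous f := by
    rw [← (Homeomorph.sigmaProdDistrib).symm.comp_continuous_iff', continuous_sigma_iff]
    intro c
    exact continuous_sigmaMk.comp (c.1.continuous_shrink A)
  have hf' : Continuous fun q : (Quot.mk (Glue E) ⁻¹' Γ.star E A) × I =>
      (Quot.mk (Glue E) (f (q.1.1, q.2)) : Γ.GlideComplex E) :=
    continuous_quot_mk.comp (hf.comp (continuous_subtype_val.prodMap continuous_id))
  refine hf'.congr fun q => ?_
  exact (if_pos q.1.2).symm

theorem isSimplyConnected_star (A : E) : IsSimplyConnected (Γ.star E A) := by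
  have : ContractibleSpace (Γ.star E A) := by
    rw [contractible_iff_id_nullhomotopic]
    refine ⟨⟨Γ.vertex A, vertex_mem_star.2 rfl⟩, ⟨⟨⟨fun q : I × Γ.star E (A : G) =>
      ⟨contract (A : G) (q.2 : Γ.GlideComplex E) (σ q.1), contract_mem_star q.2.2 _⟩, ?_⟩, ?_, ?_⟩⟩⟩
    · exact Continuous.subtype_mk ((continuous_contract (A : G)).comp
        (continuous_snd.prodMk (unitInterval.continuous_symm.comp continuous_fst))) _
    · rintro ⟨p, hp⟩
      obtain ⟨c, x, rfl⟩ := exists_eq_cubeMap p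
      refine Subtype.ext ?_
      simp [contract_cubeMap hp, BasedCube.shrink_one]
    · rintro ⟨p, hp⟩
      obtain ⟨c, x, rfl⟩ := exists_eq_cubeMap p
      refine Subtype.ext ?_
      simp [contract_cubeMap hp, BasedCube.shrink_zero, cubeMap_corner c hp.1]
  exact (inferInstance : SimplyConnectedSpace (Γ.star E A))

/-! ### Paths in a cube -/

/-- A path in `X_E` that is the image of a path in the geometric cube `c`. -/
def InCube (c : {c : Γ.BasedCube // c.vertices ⊆ E}) {p q : Γ.GlideComplex E} (γ : Path p q) :
    Prop :=
  ∃ (x y : c.1.dirs → I) (α : Path x y), ∀ t, γ t = cubeMap c (α t)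

theorem InCube.trans {c : {c : Γ.BasedCube // c.vertices ⊆ E}} {p q : Γ.GlideComplex E} {B : E}
    {γ : Path p (Γ.vertex B)} {δ : Path (Γ.vertex B) q} (h : InCube c γ) (h' : InCube c δ) :
    InCube c (γ.trans δ) := by
  obtain ⟨x, y, α, h⟩ := h
  obtain ⟨y', z, β, h'⟩ := h'
  obtain rfl : y = c.1.corner B :=
    (eq_corner_of_cubeMap_eq (by rw [← α.target, ← h, γ.target])).2
  obtain rfl : y' = c.1.corner B :=
    (eq_corner_of_cubeMap_eq (by rw [← β.source, ← h', δ.source])).2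
  refine ⟨x, z, α.trans β, fun t => ?_⟩
  rw [Path.trans_apply, Path.trans_apply]
  split_ifs
  · exact h _
  · exact h' _

theorem InCube.homotopic {c : {c : Γ.BasedCube // c.vertices ⊆ E}} {A B : E}
    {γ δ : Path (Γ.vertex A) (Γ.vertex B)} (h : InCube c γ) (h' : InCube c δ) :
    γ.Homotopic δ := by
  obtain ⟨x, y, α, h⟩ := h
  obtain ⟨x', y', β, h'⟩ := h'
  have hx : cubeMap c x = Γ.vertex A := by rw [← α.source, ← h, γ.source]
  have hy : cubeMap c y = Γ.vertex B := by rw [← α.target, ← h, γ.target]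
  have hx' : cubeMap c x' = Γ.vertex A := by rw [← β.source, ← h', δ.source]
  have hy' : cubeMap c y' = Γ.vertex B := by rw [← β.target, ← h', δ.target]
  obtain rfl : x = x' :=
    (eq_corner_of_cubeMap_eq hx).2.trans (eq_corner_of_cubeMap_eq hx').2.symm
  obtain rfl : y = y' :=
    (eq_corner_of_cubeMap_eq hy).2.trans (eq_corner_of_cubeMap_eq hy').2.symm
  have hαβ : α.Homotopic β := SimplyConnectedSpace.paths_homotopic α β
  have := (hαβ.map (cubeMap c)).pathCast hx.symm hy.symm
  convert this using 1
  · ext t; exact h t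
  · ext t; exact h' t

theorem InCube.mem_vertices {c : {c : Γ.BasedCube // c.vertices ⊆ E}} {A B : E}
    {γ : Path (Γ.vertex A) (Γ.vertex B)} (h : InCube c γ) :
    (A : G) ∈ c.1.vertices ∧ (B : G) ∈ c.1.vertices := by
  obtain ⟨x, y, α, h⟩ := h
  exact ⟨(eq_corner_of_cubeMap_eq (x := x) (by rw [← α.source, ← h, γ.source])).1,
    (eq_corner_of_cubeMap_eq (x := y) (by rw [← α.target, ← h, γ.target])).1⟩

/-- The segment from the vertex `A` to a point `p` of its open star, in a given cube containing
`p`. -/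
theorem exists_inCube_star {c : {c : Γ.BasedCube // c.vertices ⊆ E}} {A : E} {x : c.1.dirs → I}
    (h : cubeMap c x ∈ Γ.star E A) :
    ∃ α : Path (c.1.corner A) x, ∀ t, cubeMap c (α t) ∈ Γ.star E A :=
  ⟨{ toFun := c.1.shrink A x
     continuous_toFun := (c.1.continuous_shrink A).comp (continuous_const.prodMk continuous_id)
     source' := c.1.shrink_zero A x
     target' := c.1.shrink_one A x }, fun t => cubeMap_shrink_mem_star h t⟩

theorem exists_inCube (c : {c : Γ.BasedCube // c.vertices ⊆ E}) {A B : E}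
    (hA : (A : G) ∈ c.1.vertices) (hB : (B : G) ∈ c.1.vertices) :
    ∃ γ : Path (Γ.vertex A) (Γ.vertex B), InCube c γ := by
  let α : Path (c.1.corner (A : G)) (c.1.corner (B : G)) := PathConnectedSpace.somePath _ _
  exact ⟨(α.map (cubeMap c).continuous).cast (cubeMap_corner c hA).symm (cubeMap_corner c hB).symm,
    _, _, α, fun t => rfl⟩

theorem InCube.of_map {c c' : {c : Γ.BasedCube // c.vertices ⊆ E}}
    (j : C(c.1.dirs → I, c'.1.dirs → I)) (hj : ∀ x, cubeMap c x = cubeMap c' (j x))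
    {p q : Γ.GlideComplex E} {γ : Path p q} (h : InCube c γ) : InCube c' γ := by
  obtain ⟨x, y, α, h⟩ := h
  exact ⟨_, _, α.map j.continuous, fun t => (h t).trans (hj _)⟩

theorem InCube.of_subset {c c' : {c : Γ.BasedCube // c.vertices ⊆ E}}
    (hb : c.1.base = c'.1.base) (hd : c.1.dirs ⊆ c'.1.dirs)
    {p q : Γ.GlideComplex E} {γ : Path p q} (h : InCube c γ) : InCube c' γ := by
  classical
  refine h.of_map ⟨fun x s => if hs : s.1 ∈ c.1.dirs then x ⟨s.1, hs⟩ else 0, ?_⟩ fun x =>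
    Quot.sound (Glue.face c c' _ _ hb hd (fun s hs => ?_) fun s hs => dif_neg hs)
  rotate_left
  · change _ = dite _ _ _
    rw [dif_pos hs]
  refine continuous_pi fun s => ?_
  split_ifs
  · exact continuous_apply _
  · exact continuous_const

theorem InCube.of_equiv {c c' : {c : Γ.BasedCube // c.vertices ⊆ E}} (he : c.1.Equiv c'.1)
    {p q : Γ.GlideComplex E} {γ : Path p q} (h : InCube c γ) : InCube c' γ := by
  classical
  obtain ⟨T, hT, hb, hd⟩ := he
  have hmem : ∀ s : c'.1.dirs, s.1 ∈ c.1.dirs ∧ s.1 ∉ T ∨ ∃ t ∈ T, t⁻¹ = s.1 := fun s =>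
    mem_flip.1 (hd ▸ s.2)
  refine h.of_map ⟨fun x s => if hs : s.1 ∈ c.1.dirs ∧ s.1 ∉ T then x ⟨s.1, hs.1⟩
    else if hs : s.1⁻¹ ∈ c.1.dirs then σ (x ⟨s.1⁻¹, hs⟩) else 0, ?_⟩ fun x =>
    Quot.sound (Glue.rebase c c' _ _ T hT hb hd ?_ ?_)
  · refine continuous_pi fun s => ?_
    split_ifs
    · exact continuous_apply _
    · exact unitInterval.continuous_symm.comp (continuous_apply _)
    · exact continuous_const
  · intro s hs hs' hsT
    exact dif_pos ⟨hs, hsT⟩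
  · intro t ht ht'
    have h1 : ¬ (t⁻¹ ∈ c.1.dirs ∧ t⁻¹ ∉ T) := fun h => by
      have := c.1.cubic.isIndep.inv_eq_self h.1 (hT ht) rfl
      exact h.2 (this.symm ▸ ht)
    have h2 : t⁻¹⁻¹ ∈ c.1.dirs := by rw [inv_inv]; exact hT ht
    change dite _ _ _ = _
    rw [dif_neg h1, dif_pos h2]
    simp only [inv_inv]

/-- A path in a cube is a path in every cube of which it is a face. -/
theorem InCube.of_isFace {c c' : {c : Γ.BasedCube // c.vertices ⊆ E}}
    (hf : c.1.toCube.IsFace c'.1.toCube) {p q : Γ.GlideComplex E} {γ : Path p q}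
    (h : InCube c γ) : InCube c' γ := by
  obtain ⟨d, d', hd, hd', hb, hs⟩ := hf
  have e : d.Equiv c.1 := Quotient.exact hd
  have e' : d'.Equiv c'.1 := Quotient.exact hd'
  let D : {c : Γ.BasedCube // c.vertices ⊆ E} := ⟨d, e.vertices_eq ▸ c.2⟩
  let D' : {c : Γ.BasedCube // c.vertices ⊆ E} := ⟨d', e'.vertices_eq ▸ c'.2⟩
  have h1 : InCube D γ := h.of_equiv (BasedCube.Equiv.symm e)
  have h2 : InCube D' γ := h1.of_subset hb hs
  exact h2.of_equiv e'

theorem InCube.mem_cell {c : {c : Γ.BasedCube // c.vertices ⊆ E}} {p q : Γ.GlideComplex E}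
    {γ : Path p q} (h : InCube c γ) (t : I) : γ t ∈ c.1.toCube.cell E := by
  obtain ⟨x, y, α, h⟩ := h
  exact ⟨c, α t, rfl, h t⟩

/-! ### Edge paths and the homomorphism from the presented group -/

/-- The hull of a pair `{A, A}`, not covered by the hypothesis on `2`-element sets. -/
theorem isHull_zeroCube {A : G} (hA : A ∈ E) : (Γ.zeroCube A).toCube.IsHull E {A} := by
  have hv : (Γ.zeroCube A).toCube.vertices = {A} := zeroCube_vertices A
  refine ⟨?_, hv.ge, fun Q' _ h => ?_⟩
  · rw [Cube.IsIn, hv]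
    exact Set.singleton_subset_iff.2 hA
  · obtain ⟨c, rfl⟩ := Quotient.exists_rep Q'
    have hc : A ∈ c.vertices := h rfl
    exact ⟨_, c.rebase _ (c.sub_subset A), rfl,
      Quotient.sound (BasedCube.Equiv.symm (c.equiv_rebase _ _)), BasedCube.eq_bracket_sub hc,
      Finset.empty_subset _⟩

theorem exists_isHull_pair
    (hull : ∀ J : Set G, J ⊆ E → J.ncard = 2 → ∃ Q : Γ.Cube, Q.IsHull E J) (A B : E) :
    ∃ Q : Γ.Cube, Q.IsHull E {(A : G), (B : G)} := by
  by_cases h : (A : G) = B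
  · rw [h, Set.pair_eq_singleton]
    exact ⟨_, isHull_zeroCube B.2⟩
  · exact hull _ (Set.pair_subset A.2 B.2) (Set.ncard_pair h)

variable (Γ) in
/-- A path from `A` to `B` that is the image of a path in a geometric cube representing the hull
of `{A, B}`. -/
def IsEdge {A B : E} (γ : Path (Γ.vertex A) (Γ.vertex B)) : Prop :=
  ∃ c : {c : Γ.BasedCube // c.vertices ⊆ E},
    c.1.toCube.IsHull E {(A : G), (B : G)} ∧ InCube c γ

theorem exists_isEdge {A B : E} (h : ∃ Q : Γ.Cube, Q.IsHull E {(A : G), (B : G)}) :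
    ∃ γ : Path (Γ.vertex A) (Γ.vertex B), Γ.IsEdge γ := by
  obtain ⟨Q, hQ⟩ := h
  obtain ⟨c, rfl⟩ := Quotient.exists_rep Q
  obtain ⟨γ, hγ⟩ := exists_inCube ⟨c, hQ.1⟩ (hQ.2.1 (.inl rfl)) (hQ.2.1 (.inr rfl))
  exact ⟨γ, ⟨c, hQ.1⟩, hQ, hγ⟩

theorem IsEdge.inHull {A B : E} {γ : Path (Γ.vertex A) (Γ.vertex B)} (h : Γ.IsEdge γ) :
    Γ.InHull γ := by
  obtain ⟨c, hc, h⟩ := h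
  exact ⟨_, hc, h.mem_cell⟩

/-- The hull of `{A, B}` being a face of every cube with vertices `A` and `B`, all paths from `A`
to `B` in cubes are homotopic. -/
theorem IsEdge.homotopic {A B : E} {γ δ : Path (Γ.vertex A) (Γ.vertex B)} (h : Γ.IsEdge γ)
    {c : {c : Γ.BasedCube // c.vertices ⊆ E}} (hδ : InCube c δ) : δ.Homotopic γ := by
  obtain ⟨c₀, h₀, hγ⟩ := h
  refine hδ.homotopic (hγ.of_isFace (h₀.2.2 c.1.toCube c.2 ?_))
  rintro _ (rfl | rfl)
  exacts [hδ.mem_vertices.1, hδ.mem_vertices.2]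

section

open Path

variable {e : ∀ A B : E, Path (Γ.vertex A) (Γ.vertex B)}

theorem mk_edge_trans (he : ∀ A B, Γ.IsEdge (e A B)) {A B C : E} {Q : Γ.Cube}
    (hQ : Q.IsIn E) (hA : (A : G) ∈ Q.vertices) (hB : (B : G) ∈ Q.vertices)
    (hC : (C : G) ∈ Q.vertices) :
    (Homotopic.Quotient.mk (e A B)).trans (Homotopic.Quotient.mk (e B C)) =
      Homotopic.Quotient.mk (e A C) := by
  obtain ⟨c, rfl⟩ := Quotient.exists_rep Q
  obtain ⟨γ, hγ⟩ := exists_inCube ⟨c, hQ⟩ hA hB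
  obtain ⟨δ, hδ⟩ := exists_inCube ⟨c, hQ⟩ hB hC
  rw [← Homotopic.Quotient.eq.2 ((he A B).homotopic hγ),
    ← Homotopic.Quotient.eq.2 ((he B C).homotopic hδ),
    ← Homotopic.Quotient.eq.2 ((he A C).homotopic (hγ.trans hδ)), Homotopic.Quotient.mk_trans]

theorem mk_edge_self (he : ∀ A B, Γ.IsEdge (e A B)) (A : E) :
    Homotopic.Quotient.mk (e A A) = Homotopic.Quotient.refl _ := by
  obtain ⟨c, hc, h⟩ := he A A
  have hA := h.mem_vertices.1
  have h1 := mk_edge_trans he (Q := c.1.toCube) c.2 hA hA hA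
  have h2 := congrArg (fun q => (Homotopic.Quotient.mk (e A A)).symm.trans q) h1
  simpa only [← Homotopic.Quotient.trans_assoc, Homotopic.Quotient.symm_trans,
    Homotopic.Quotient.refl_trans] using h2

theorem mk_edge_trans_symm (he : ∀ A B, Γ.IsEdge (e A B)) (A B : E) :
    (Homotopic.Quotient.mk (e A B)).trans (Homotopic.Quotient.mk (e B A)) =
      Homotopic.Quotient.refl _ := by
  obtain ⟨c, hc, h⟩ := he A B
  rw [mk_edge_trans he (Q := c.1.toCube) c.2 h.mem_vertices.1 h.mem_vertices.2 h.mem_vertices.1,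
    mk_edge_self he]

theorem mk_edge_symm (he : ∀ A B, Γ.IsEdge (e A B)) (A B : E) :
    (Homotopic.Quotient.mk (e A B)).symm = Homotopic.Quotient.mk (e B A) := by
  have h := congrArg (fun q => (Homotopic.Quotient.mk (e A B)).symm.trans q)
    (mk_edge_trans_symm he A B)
  simpa only [← Homotopic.Quotient.trans_assoc, Homotopic.Quotient.symm_trans,
    Homotopic.Quotient.refl_trans, Homotopic.Quotient.trans_refl] using h.symm

/-- The homomorphism from the presented group to `π₁(X_E, A₀)` given by a choice `e` of edge paths:
it sends `y_{A,B}` to the class of the loop through `A₀`, `A`, `B`, `A₀`. -/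
noncomputable def edgeHom (he : ∀ A B, Γ.IsEdge (e A B)) (A₀ : E) :
    PresentedGroup (Γ.relators E A₀) →* Γ.GlideGroup A₀ :=
  PresentedGroup.toGroup
    (f := fun q => Γ.loopClass (((e A₀ q.1).trans (e q.1 q.2)).trans (e q.2 A₀))) <| by
    rintro r (⟨A, B, C, Q, hQ, hA, hB, hC, rfl⟩ | ⟨A, rfl⟩)
    · rw [map_mul, map_mul, map_inv, mul_inv_eq_one]
      simp only [FreeGroup.lift_apply_of]
      rw [← loopClass_trans]
      refine congrArg MulOpposite.op ?_
      simp only [Homotopic.Quotient.mk_trans, Homotopic.Quotient.trans_assoc,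
        FundamentalGroup.fromPath, FundamentalGroup.fromArrow]
      rw [← Homotopic.Quotient.trans_assoc (Homotopic.Quotient.mk (e B A₀)),
        mk_edge_trans_symm he, Homotopic.Quotient.refl_trans,
        ← Homotopic.Quotient.trans_assoc (Homotopic.Quotient.mk (e A B)),
        mk_edge_trans he hQ hA hB hC]
    · simp only [FreeGroup.lift_apply_of]
      refine congrArg MulOpposite.op ?_
      simp only [Homotopic.Quotient.mk_trans, Homotopic.Quotient.trans_assoc,
        mk_edge_trans_symm he, mk_edge_self he,
        Homotopic.Quotient.trans_refl]
      rfl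

theorem edgeHom_of (he : ∀ A B, Γ.IsEdge (e A B)) (A₀ A B : E) :
    edgeHom he A₀ (PresentedGroup.of (A, B)) =
      Γ.loopClass (((e A₀ A).trans (e A B)).trans (e B A₀)) :=
  PresentedGroup.toGroup.of _

theorem edgeHom_surjective (he : ∀ A B, Γ.IsEdge (e A B)) (A₀ : E) :
    Function.Surjective (edgeHom he A₀) := by
  have key : (edgeHom he A₀).range.unop = ⊤ := by
    refine fundamentalGroup_subgroup_eq_top (U := fun A : E => Γ.star E (A : G))
      (fun A => isOpen_star _) exists_mem_star isSimplyConnected_star (v := Γ.vertex)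
      (fun A => vertex_mem_star.2 rfl) (e A₀) (Homotopic.Quotient.eq.1 (mk_edge_self he A₀)) _ ?_
    intro x A B hA hB
    obtain ⟨c, x, rfl⟩ := exists_eq_cubeMap x
    obtain ⟨α, hα⟩ := exists_inCube_star hA
    obtain ⟨β, hβ⟩ := exists_inCube_star hB
    let p : Path (Γ.vertex A) (cubeMap c x) :=
      (α.map (cubeMap c).continuous).cast (cubeMap_corner c hA.1).symm rfl
    let q : Path (Γ.vertex B) (cubeMap c x) :=
      (β.map (cubeMap c).continuous).cast (cubeMap_corner c hB.1).symm rfl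
    refine ⟨p, q, hα, hβ, PresentedGroup.of (A, B), ?_⟩
    have hpq : InCube c (p.trans q.symm) := by
      refine ⟨_, _, α.trans β.symm, fun t => ?_⟩
      rw [Path.trans_apply, Path.trans_apply]
      split_ifs <;> rfl
    -- the segments from `A` and `B` to a common point of their stars form an edge path
    have hE := Homotopic.Quotient.eq.2 ((he A B).homotopic hpq)
    rw [edgeHom_of]
    refine congrArg MulOpposite.op ?_
    simp only [Path.trans_symm, Homotopic.Quotient.mk_trans, Homotopic.Quotient.mk_symm,
      FundamentalGroup.fromPath, FundamentalGroup.fromArrow] at hE ⊢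
    rw [← hE, ← mk_edge_symm he A₀ B]
    simp only [Homotopic.Quotient.trans_assoc]
  intro g
  have : g.unop ∈ (edgeHom he A₀).range.unop := key ▸ Subgroup.mem_top _
  exact this

end

/-! ### Monodromy of paths in cells -/

theorem of_mul_of {A₀ A B C : E} {Q : Γ.Cube} (hQ : Q.IsIn E) (hA : (A : G) ∈ Q.vertices)
    (hB : (B : G) ∈ Q.vertices) (hC : (C : G) ∈ Q.vertices) :
    (PresentedGroup.of (A, B) * PresentedGroup.of (B, C) : PresentedGroup (Γ.relators E A₀)) =
      PresentedGroup.of (A, C) := by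
  rw [← mul_inv_eq_one]
  exact PresentedGroup.one_of_mem (.inl ⟨A, B, C, Q, hQ, hA, hB, hC, rfl⟩)

theorem of_base (A₀ A : E) :
    (PresentedGroup.of (A₀, A) : PresentedGroup (Γ.relators E A₀)) = 1 :=
  PresentedGroup.one_of_mem (.inr ⟨A, rfl⟩)

theorem of_self (A₀ A : E) :
    (PresentedGroup.of (A, A) : PresentedGroup (Γ.relators E A₀)) = 1 := by
  obtain ⟨h1, h2, -⟩ := isHull_zeroCube (Γ := Γ) A.2
  exact mul_eq_left.1 (of_mul_of h1 (h2 rfl) (h2 rfl) (h2 rfl))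

theorem mem_cell_star {Q : Γ.Cube} {p : Γ.GlideComplex E} (hp : p ∈ Q.cell E) {A : G}
    (hA : p ∈ Γ.star E A) : A ∈ Q.vertices := by
  obtain ⟨c, x, rfl, rfl⟩ := hp
  exact hA.1

/-- The parallel transport of the covering of `X_E` with fiber the presented group, defined by the
generators `y_{A,B}` as a cocycle on the open stars. Along a path in a closed cell from `A` to `B`
it is right multiplication by `y_{A,B}`. -/
theorem exists_transport (Γ : GlidingSystem G) (A₀ : E) :
    ∃ M : ∀ {A B : E}, Path.Homotopic.Quotient (Γ.vertex A) (Γ.vertex B) →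
        PresentedGroup (Γ.relators E A₀) → PresentedGroup (Γ.relators E A₀),
      (∀ A v, M (.refl (Γ.vertex A)) v = v) ∧
      (∀ {A B C : E} (γ : Path.Homotopic.Quotient (Γ.vertex A) (Γ.vertex B))
        (δ : Path.Homotopic.Quotient (Γ.vertex B) (Γ.vertex C)) v,
          M (γ.trans δ) v = M δ (M γ v)) ∧
      ∀ {A B : E} (γ : Path (Γ.vertex A) (Γ.vertex B)) (Q : Γ.Cube), Q.IsIn E →
        (∀ t, γ t ∈ Q.cell E) → ∀ v, M (.mk γ) v = v * PresentedGroup.of (A, B) := by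
  choose k hk using exists_mem_star (Γ := Γ) (E := E)
  obtain ⟨M, hM1, hM2, hM3⟩ := exists_parallel_transport (P := PresentedGroup (Γ.relators E A₀))
    (fun A : E => isOpen_star (Γ := Γ) (A : G)) hk (g := fun A B => PresentedGroup.of (A, B)) (by
      rintro A B C ⟨p, ⟨hA, hB⟩, hC⟩
      obtain ⟨c, x, rfl⟩ := exists_eq_cubeMap p
      exact of_mul_of (Q := c.1.toCube) c.2 hA.1 hB.1 hC.1)
  refine ⟨M, fun A => hM1 _, hM2, fun {A B} γ Q hQ hγ v => ?_⟩
  have hkv (A : E) : k (Γ.vertex A) = A := Subtype.ext (vertex_mem_star.1 (hk (Γ.vertex A)))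
  have hA : (A : G) ∈ Q.vertices :=
    mem_cell_star (γ.source ▸ hγ 0) (vertex_mem_star.2 rfl)
  -- the section of the covering over the cell whose value on the star of `C` is `v * y_{A,C}`
  have := hM3 γ (fun C => v * PresentedGroup.of (A, C)) fun t C D hC hD => by
    rw [mul_assoc, of_mul_of hQ hA (mem_cell_star (hγ t) hC) (mem_cell_star (hγ t) hD)]
  simpa only [hkv, of_self, mul_one] using this

theorem pathConnectedSpace [Nonempty E]
    (h : ∀ A B : E, ∃ Q : Γ.Cube, Q.IsHull E {(A : G), (B : G)}) :
    PathConnectedSpace (Γ.GlideComplex E) := by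
  obtain ⟨A₀⟩ := ‹Nonempty E›
  have key (p : Γ.GlideComplex E) : Joined (Γ.vertex A₀) p := by
    obtain ⟨A, hA⟩ := exists_mem_star p
    obtain ⟨γ, -⟩ := exists_isEdge (h A₀ A)
    exact Joined.trans ⟨γ⟩
      ((isSimplyConnected_star A).isPathConnected.joinedIn _ (vertex_mem_star.2 rfl) _ hA).joined
  exact ⟨⟨Γ.vertex A₀⟩, fun p q => (key p).symm.trans (key q)⟩

end GlidingSystem

open GlidingSystem in
theorem mainTheorem9 {G : Type*} [Group G] (Γ : GlidingSystem G) (E : Set G)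
    (hull : ∀ J : Set G, J ⊆ E → J.ncard = 2 → ∃ Q : Γ.Cube, Q.IsHull E J) :
    (E.Nonempty → ConnectedSpace (Γ.GlideComplex E)) ∧
      ∀ A₀ : E, ∃ Φ : PresentedGroup (Γ.relators E A₀) ≃* Γ.GlideGroup A₀,
        ∀ A B : E,
          (∃ γ : Path (Γ.vertex A₀) (Γ.vertex A₀), Γ.IsHullLoop A₀ A B γ) ∧
          ∀ γ : Path (Γ.vertex A₀) (Γ.vertex A₀), Γ.IsHullLoop A₀ A B γ →
            Φ (PresentedGroup.of (A, B)) = Γ.loopClass γ := by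
  have hpair := exists_isHull_pair hull
  refine ⟨fun hE => ?_, fun A₀ => ?_⟩
  · have := hE.to_subtype
    have := pathConnectedSpace hpair
    infer_instance
  choose e he using fun A B => exists_isEdge (hpair A B)
  obtain ⟨M, hM1, hM2, hM3⟩ := exists_transport Γ A₀
  have hM_hull {A B : E} {p : Path (Γ.vertex A) (Γ.vertex B)} (hp : Γ.InHull p)
      (v : PresentedGroup (Γ.relators E A₀)) :
      M (.mk p) v = v * PresentedGroup.of (A, B) := by
    obtain ⟨Q, hQ, hp⟩ := hp
    exact hM3 p Q hQ.1 hp v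
  have hinv (B : E) :
      (PresentedGroup.of (B, A₀) : PresentedGroup (Γ.relators E A₀)) = 1 := by
    obtain ⟨Q, hQ⟩ := hpair A₀ B
    have hA : (A₀ : G) ∈ Q.vertices := hQ.2.1 (.inl rfl)
    have hB : (B : G) ∈ Q.vertices := hQ.2.1 (.inr rfl)
    simpa only [of_base, one_mul, of_self] using of_mul_of (A₀ := A₀) hQ.1 hA hB hA
  have hloop {A B : E} {γ : Path (Γ.vertex A₀) (Γ.vertex A₀)} (hγ : Γ.IsHullLoop A₀ A B γ)
      (v : PresentedGroup (Γ.relators E A₀)) :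
      M (.mk γ) v = v * PresentedGroup.of (A, B) := by
    obtain ⟨p, q, r, hp, hq, hr, rfl⟩ := hγ
    rw [Path.Homotopic.Quotient.mk_trans, Path.Homotopic.Quotient.mk_trans, hM2, hM2, hM_hull hp,
      hM_hull hq, hM_hull hr, of_base, hinv, mul_one, mul_one]
  have hedge (A B : E) : Γ.IsHullLoop A₀ A B (((e A₀ A).trans (e A B)).trans (e B A₀)) :=
    ⟨_, _, _, (he _ _).inHull, (he _ _).inHull, (he _ _).inHull, rfl⟩
  -- parallel transport along the image of `g` is right multiplication by `g`
  have hM (g : PresentedGroup (Γ.relators E A₀)) :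
      ∀ v, M (edgeHom he A₀ g).unop.toPath v = v * g := by
    have hg : g ∈ Subgroup.closure (Set.range (PresentedGroup.of (rels := Γ.relators E A₀))) := by
      rw [PresentedGroup.closure_range_of]
      exact Subgroup.mem_top g
    induction hg using Subgroup.closure_induction with
    | mem g h =>
      obtain ⟨⟨A, B⟩, rfl⟩ := h
      rw [edgeHom_of]
      exact hloop (hedge A B)
    | one =>
      intro v
      rw [map_one, mul_one]
      exact hM1 A₀ v
    | mul g h _ _ ihg ihh =>
      intro v
      rw [map_mul, ← mul_assoc, ← ihg v, ← ihh]
      exact hM2 _ _ v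
    | inv g _ ih =>
      intro v
      have h1 := ih (v * g⁻¹)
      rw [inv_mul_cancel_right] at h1
      rw [map_inv]
      conv_lhs => rw [← h1]
      refine (hM2 _ _ _).symm.trans ?_
      exact (congrArg (M · _) (Path.Homotopic.Quotient.trans_symm _)).trans (hM1 A₀ _)
  have hinj : Function.Injective (edgeHom he A₀) := fun g h hgh => by
    rw [← one_mul g, ← hM g 1, hgh, hM h 1, one_mul]
  refine ⟨MulEquiv.ofBijective _ ⟨hinj, edgeHom_surjective he A₀⟩, fun A B =>
    ⟨⟨_, hedge A B⟩, fun γ hγ => ?_⟩⟩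
  obtain ⟨g, hg⟩ := edgeHom_surjective he A₀ (Γ.loopClass γ)
  have h1 := hM g 1
  rw [hg, one_mul] at h1
  have h2 : M (.mk γ) 1 = PresentedGroup.of (A, B) := by rw [hloop hγ, one_mul]
  exact (congrArg _ (h2.symm.trans h1)).trans hg
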